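/- Let $A\in\mathbb{R}^{n\times m}$ be a nonzero matrix with columns $a_1,\dots,a_m$ and singular values $\sigma_i(A)$, and let $$\mathrm{srank}_4(A)=\frac{\big(\sum_i\sigma_i(A)^2\big)^2}{\sum_i\sigma_i(A)^4}.$$ Let $\tilde A$ denote the matrix $A$ with normalized columns, that is, every nonzero column $a_j$ is replaced by $a_j/\|a_j\|_2$ (zero columns, if there are any, are left unchanged). For a subset $\mathcal S\subseteq\{1,\dots,m\}$ let $\tilde A_{\mathcal S}$ be the submatrix of $\tilde A$ formed by the columns indexed by $\mathcal S$, and let $\sigma_{\min}(M)=\min_{\|x\|_2=1}\|Mx\|_2$ denote the least singular value of a matrix $M$. Then for every $\epsilon\in(0,1)$ there exists a subset $\mathcal S\subseteq\{1,\dots,m\}$ of size $$k=\big\lfloor(1-\epsilon)^2\,\mathrm{srank}_4(A)\big\rfloor+1$$ such that $$\sigma_{\min}(\tilde A_{\mathcal S})\ge\epsilon.$$ In particular this holds with $k=(1-\epsilon)^2\,\mathrm{srank}_4(A)+1$ whenever that number is an integer. -/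

import Mathlib

noncomputable section

/-- The Schatten `4`-norm stable rank `(∑ σᵢ(A)²)² / ∑ σᵢ(A)⁴` of a real `n × m` matrix. The
singular values are Mathlib's: zero-indexed, decreasing, and zero from the index `m` on, so that
both sums run over all nonzero singular values. -/
def srankFour {n m : ℕ} (A : Matrix (Fin n) (Fin m) ℝ) : ℝ :=
  (∑ i ∈ Finset.range m, A.toEuclideanLin.singularValues i ^ 2) ^ 2 /
    ∑ i ∈ Finset.range m, A.toEuclideanLin.singularValues i ^ 4

/-- The least singular value `min_{‖x‖₂ = 1} ‖M x‖₂` of a real matrix. For a nonempty set `κ` of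
column indices the unit sphere is compact and nonempty, and the infimum is a minimum. -/
def sigmaMin {n : ℕ} {κ : Type*} [Fintype κ] [DecidableEq κ] (M : Matrix (Fin n) κ ℝ) : ℝ :=
  ⨅ x : Metric.sphere (0 : EuclideanSpace ℝ κ) 1, ‖M.toEuclideanLin (x : EuclideanSpace ℝ κ)‖

/-- The matrix `A` with normalized columns: the `j`-th column `a_j` is replaced by
`a_j / ‖a_j‖₂`; a zero column stays zero. -/
def normalizeCols {n m : ℕ} (A : Matrix (Fin n) (Fin m) ℝ) : Matrix (Fin n) (Fin m) ℝ :=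
  Matrix.of fun i j => A i j / ‖WithLp.toLp 2 (A.col j)‖

/-- The submatrix of `A` formed by the columns with index in `S`. -/
def colsSubmatrix {n m : ℕ} (A : Matrix (Fin n) (Fin m) ℝ) (S : Finset (Fin m)) :
    Matrix (Fin n) S ℝ :=
  A.submatrix id Subtype.val

end

/-! Draw `k + 1` columns of `normalizeCols A` independently, column `j` with probability `‖a_j‖² /
s`, where `s = ∑ σᵢ²`. A single draw has `E[v vᵀ] = A Aᵀ / s`, whose nonzero eigenvalues are the
nonzero `μ i = σᵢ² / s`. Each draw acts on expected determinants as `1 - D`. Hence the expectation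
of `det (G - X)`, with `G` the Gram matrix of the draw, is `± ∏ (1 - μ i D) X ^ (k + 1)`
(`expectedGramPoly_nil_eq`).

In general the roots of an average say little about the roots of its terms. Here the conditional
expectations `p i`, given the next column `i`, are all compared with the polynomial `f` that omits
this column: every `p i / (x f)` is decreasing, as its negative maps the upper half-plane to the
closed upper half-plane. So some choice of the next column keeps the polynomial positive on `(-∞,
b]` (`exists_expectedGramPoly_cons_pos`). With `b = ε²` this ends at a fixed draw whose Gram matrix
has all eigenvalues above `ε²`; it repeats no column, so it is a set of the right size.

It remains to see that the expected polynomial has all roots above `ε²` (`exists_roots_gt_sq`). Keep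
the potential `∑ 1 / (r - b)` at most `φ`. The roots of `X ^ (k + 1)` allow the barrier `b = -(k +
1) / φ`, each factor `1 - μ D` raises it by `μ / (1 + μ φ)`, and the roots stay `1 / φ` above it. By
Cauchy–Schwarz the shifts add up to at least `1 / (1 + φ τ)`, where `τ = ∑ μ² = 1 / srankFour A`;
the best `φ` gives the bound `(1 - √(k τ))² ≥ ε²`. -/

open Polynomial Matrix

/-! ### Rank one updates of determinants. -/

/-- The derivative of a determinant of polynomials (Jacobi's formula). -/
theorem derivative_det_eq_trace {R d : Type*} [CommRing R] [Fintype d] [DecidableEq d]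
    (N : Matrix d d R[X]) :
    derivative N.det = (N.adjugate * N.map derivative).trace := by
  have h1 : ∀ j, (N.adjugate * N.map derivative) j j
      = (N.updateCol j fun i => derivative (N i j)).det := fun j => by
    rw [← cramer_apply, cramer_eq_adjugate_mulVec]
    rfl
  simp only [trace, diag, h1]
  simp only [det_apply, derivative_sum, Units.smul_def, derivative_smul, derivative_prod_finset]
  conv_rhs => rw [Finset.sum_comm]
  refine Finset.sum_congr rfl fun σ _ => ?_
  rw [← Finset.smul_sum]
  congr 1
  refine Finset.sum_congr rfl fun j _ => ?_
  rw [← Finset.prod_erase_mul _ _ (Finset.mem_univ j)]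
  congr 1
  · exact Finset.prod_congr rfl fun i hi => by
      rw [updateCol_ne (Finset.ne_of_mem_erase hi)]
  · simp

/-- The determinant is affine along a rank one update. -/
theorem det_add_smul_vecMulVec_affine {R d : Type*} [CommRing R] [Fintype d] [DecidableEq d]
    (N : Matrix d d R) (u v : d → R) :
    ∃ β : R, ∀ t : R, (N + t • vecMulVec u v).det = N.det + t * β := by
  -- Schur complement of a bordered matrix: `t` occurs only in the last row, in which the
  -- determinant is linear.
  have key : ∀ t : R, (N + t • vecMulVec u v).det
      = (fromBlocks N (replicateCol Unit u) (replicateRow Unit (-t • v)) 1).det := fun t => by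
    rw [det_fromBlocks_one₂₂, ← vecMulVec_eq, vecMulVec_smul, neg_smul, sub_neg_eq_add]
  let F : Matrix (d ⊕ Unit) (d ⊕ Unit) R := fromBlocks N (replicateCol Unit u) 0 1
  have key2 : ∀ t : R, (N + t • vecMulVec u v).det
      = (F.updateRow (Sum.inr ()) (t • Sum.elim (-v) (0 : Unit → R)
          + Sum.elim (0 : d → R) (1 : Unit → R))).det := fun t => by
    rw [key]
    congr 1
    ext i j
    rcases i with i | i <;> rcases j with j | j <;> simp [F, updateRow_apply, replicateRow]
  refine ⟨(F.updateRow (Sum.inr ()) (Sum.elim (-v) (0 : Unit → R))).det, fun t => ?_⟩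
  have h0 := key2 0
  rw [zero_smul, add_zero, zero_smul, zero_add] at h0
  rw [key2, det_updateRow_add, det_updateRow_smul, h0, add_comm]

/-- The slope of the affine function `t ↦ det (N + t u vᵀ)` is its derivative at `0`, which Jacobi's
formula gives. The adjugate avoids any invertibility assumption. -/
theorem det_add_vecMulVec {R d : Type*} [CommRing R] [Fintype d] [DecidableEq d]
    (N : Matrix d d R) (u v : d → R) :
    (N + vecMulVec u v).det = N.det + (N.adjugate * vecMulVec u v).trace := by
  obtain ⟨β, hβ⟩ := det_add_smul_vecMulVec_affine (N.map C) (C ∘ u) (C ∘ v)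
  have hm : ∀ t : R[X], (N.map C + t • vecMulVec (C ∘ u) (C ∘ v)).map (eval 0)
      = N + (eval 0 t) • vecMulVec u v := fun t => by
    ext i j; simp [vecMulVec_apply]
  have hm1 : ∀ t : R[X], (N.map C + t • vecMulVec (C ∘ u) (C ∘ v)).map (eval 1)
      = N + (eval 1 t) • vecMulVec u v := fun t => by
    ext i j; simp [vecMulVec_apply]
  have hd := derivative_det_eq_trace (N.map C + (X : R[X]) • vecMulVec (C ∘ u) (C ∘ v))
  obtain ⟨γ, hγ⟩ := det_add_smul_vecMulVec_affine N u v
  have e1 : (N.map C + (X : R[X]) • vecMulVec (C ∘ u) (C ∘ v)).det = C N.det + X * β := by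
    rw [hβ]; congr 1; exact ((C : R →+* R[X]).map_det N).symm
  have e2 : β = C γ := by
    have h1 := hβ 1
    have h2 : N.map C + (1 : R[X]) • vecMulVec (C ∘ u) (C ∘ v)
        = (N + (1 : R) • vecMulVec u v).map C := by
      ext i j; simp [vecMulVec_apply]
    rw [h2, one_mul] at h1
    have h3 := (C : R →+* R[X]).map_det (N + (1 : R) • vecMulVec u v)
    have h4 := (C : R →+* R[X]).map_det N
    simp only [RingHom.mapMatrix_apply] at h3 h4
    rw [← h3, ← h4, hγ] at h1
    simpa using h1.symm
  rw [e1, e2] at hd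
  have hd0 := congrArg (eval 0) hd
  simp only [derivative_add, derivative_C, derivative_mul, derivative_X, one_mul, mul_zero,
    add_zero, zero_add, eval_C] at hd0
  have h5 := hγ 1
  rw [one_smul, one_mul] at h5
  rw [h5, hd0]
  congr 1
  have h6 := (evalRingHom (0 : R)).map_adjugate
    (N.map C + (X : R[X]) • vecMulVec (C ∘ u) (C ∘ v))
  have h7 : (evalRingHom (0 : R)).mapMatrix (N.map C + (X : R[X]) • vecMulVec (C ∘ u) (C ∘ v))
      = N := by
    ext i j; simp
  rw [h7] at h6
  rw [← h6]
  simp [trace, mul_apply, eval_finsetSum, vecMulVec_apply]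

/-! ### Expected determinants and the operator `1 - D`. -/

section


/-- The rank one matrix `u uᵀ` with entries in an `ℝ`-algebra. -/
def outer (R : Type*) [CommRing R] [Algebra ℝ R] {d : Type*} (u : d → ℝ) : Matrix d d R :=
  vecMulVec (algebraMap ℝ R ∘ u) (algebraMap ℝ R ∘ u)

theorem outer_map {R S d : Type*} [CommRing R] [Algebra ℝ R] [CommRing S] [Algebra ℝ S]
    (f : R →ₐ[ℝ] S) (u : d → ℝ) : (outer R u).map f = outer S u := by
  ext i j; simp [outer, vecMulVec_apply]

variable {ι d : Type*} [Fintype ι] [Fintype d] [DecidableEq d]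
variable {R S : Type*} [CommRing R] [Algebra ℝ R] [CommRing S] [Algebra ℝ S]

/-- The expectation of `det (N - ∑ v vᵀ)` over `l` independent vectors `v`, each equal to `v i`
with weight `w i`. -/
def expectedDet (w : ι → ℝ) (v : ι → d → ℝ) : ℕ → Matrix d d R → R
  | 0, N => N.det
  | l + 1, N => ∑ i, algebraMap ℝ R (w i) * expectedDet w v l (N - outer R (v i))

theorem expectedDet_map (w : ι → ℝ) (v : ι → d → ℝ) (f : R →ₐ[ℝ] S) (l : ℕ)
    (N : Matrix d d R) : f (expectedDet w v l N) = expectedDet w v l (N.map f) := by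
  induction l generalizing N with
  | zero => exact (f : R →+* S).map_det N
  | succ l ih =>
    simp only [expectedDet, map_sum, map_mul, ih, AlgHom.commutes]
    refine Finset.sum_congr rfl fun i _ => ?_
    rw [Matrix.map_sub _ (map_sub f), outer_map]

/-- When `N' = E[v vᵀ]`, Jacobi's formula and the rank one update both produce `tr (adj N · E[v
vᵀ])`. Subtracting the constant matrix `v vᵀ` preserves `N'`, so the induction runs. -/
theorem derivative_expectedDet (w : ι → ℝ) (v : ι → d → ℝ) (hw : ∑ i, w i = 1) (l : ℕ)
    (N : Matrix d d ℝ[X]) (hN : N.map derivative = ∑ i, C (w i) • outer ℝ[X] (v i)) :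
    derivative (expectedDet w v l N) = expectedDet w v l N - expectedDet w v (l + 1) N := by
  have hw' : ∑ i, (C (w i) : ℝ[X]) = 1 := by rw [← map_sum, hw, map_one]
  induction l generalizing N with
  | zero =>
    simp only [expectedDet, algebraMap_eq]
    have h : ∀ i, (N - outer ℝ[X] (v i)).det
        = N.det - (N.adjugate * outer ℝ[X] (v i)).trace := fun i => by
      have := det_add_vecMulVec N (-(algebraMap ℝ ℝ[X] ∘ v i)) (algebraMap ℝ ℝ[X] ∘ v i)
      rw [neg_vecMulVec, Matrix.mul_neg, trace_neg, ← sub_eq_add_neg, ← sub_eq_add_neg] at this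
      exact this
    rw [derivative_det_eq_trace, hN]
    simp only [h, mul_sub, Finset.sum_sub_distrib, ← Finset.sum_mul, hw', one_mul,
      sub_sub_cancel, Matrix.mul_sum, trace_sum, Matrix.mul_smul, trace_smul, smul_eq_mul]
  | succ l ih =>
    have hN' : ∀ i, (N - outer ℝ[X] (v i)).map derivative
        = ∑ i, C (w i) • outer ℝ[X] (v i) := fun i => by
      rw [← hN]; ext a b
      have : derivative (C (v i a) * C (v i b)) = 0 := by rw [← C_mul, derivative_C]
      simp [outer, vecMulVec_apply, this]
    conv_lhs => rw [expectedDet]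
    conv_rhs => rw [expectedDet, expectedDet]
    simp only [algebraMap_eq, derivative_sum, derivative_C_mul]
    rw [← Finset.sum_sub_distrib]
    refine Finset.sum_congr rfl fun i _ => ?_
    rw [ih _ (hN' i), mul_sub]

theorem expectedDet_eq_iterate (w : ι → ℝ) (v : ι → d → ℝ) (hw : ∑ i, w i = 1) (l : ℕ)
    (N : Matrix d d ℝ[X]) (hN : N.map derivative = ∑ i, C (w i) • outer ℝ[X] (v i)) :
    expectedDet w v l N = ((1 - derivative : Module.End ℝ ℝ[X]) ^ l) N.det := by
  induction l with
  | zero => rfl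
  | succ l ih =>
    rw [pow_succ', Module.End.mul_apply, ← ih, LinearMap.sub_apply, Module.End.one_apply,
      derivative_expectedDet w v hw l N hN, sub_sub_cancel]

end

/-! ### Nonvanishing for matrices with positive definite imaginary part. -/

section

variable {ι d : Type*} [Fintype ι] [Fintype d]

/-- The Hermitian form of the imaginary part of a complex matrix is positive definite. -/
def ImPosDef (N : Matrix d d ℂ) : Prop :=
  ∀ x : d → ℂ, x ≠ 0 → 0 < (star x ⬝ᵥ N *ᵥ x).im

theorem star_dotProduct_outer_mulVec (u : d → ℝ) (x : d → ℂ) :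
    star x ⬝ᵥ outer ℂ u *ᵥ x = (Complex.normSq ((fun i => (u i : ℂ)) ⬝ᵥ x) : ℂ) := by
  have h : star x ⬝ᵥ (fun i => (u i : ℂ)) =
      (starRingEnd ℂ) ((fun i => (u i : ℂ)) ⬝ᵥ x) := by
    simp [dotProduct, mul_comm]
  have h2 : outer ℂ u = vecMulVec (fun i => (u i : ℂ)) (fun i => (u i : ℂ)) := rfl
  rw [h2, vecMulVec_mulVec, Complex.normSq_eq_conj_mul_self, ← h, dotProduct_smul]
  simp [mul_comm]

theorem ImPosDef.add_smul_outer {N : Matrix d d ℂ} (hN : ImPosDef N) (u : d → ℝ) {t : ℂ}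
    (ht : 0 ≤ t.im) : ImPosDef (N + t • outer ℂ u) := fun x hx => by
  rw [add_mulVec, dotProduct_add, smul_mulVec, dotProduct_smul, star_dotProduct_outer_mulVec,
    Complex.add_im, smul_eq_mul, Complex.im_mul_ofReal]
  exact add_pos_of_pos_of_nonneg (hN x hx) (mul_nonneg ht (Complex.normSq_nonneg _))

theorem ImPosDef.sub_outer {N : Matrix d d ℂ} (hN : ImPosDef N) (u : d → ℝ) :
    ImPosDef (N - outer ℂ u) := by
  have := hN.add_smul_outer u (t := -1) (by simp)
  rwa [neg_one_smul, ← sub_eq_add_neg] at this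

variable [DecidableEq d]

theorem ImPosDef.det_ne_zero {N : Matrix d d ℂ} (hN : ImPosDef N) : N.det ≠ 0 := fun h => by
  obtain ⟨x, hx, hx0⟩ := exists_mulVec_eq_zero_iff.2 h
  simpa [hx0] using hN x hx

theorem expectedDet_affine (w : ι → ℝ) (v : ι → d → ℝ) (u : d → ℝ) (l : ℕ)
    (N : Matrix d d ℂ) : ∃ β : ℂ, ∀ t : ℂ,
      expectedDet w v l (N + t • outer ℂ u) = expectedDet w v l N + t * β := by
  induction l generalizing N with
  | zero => exact det_add_smul_vecMulVec_affine _ _ _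
  | succ l ih =>
    choose β hβ using fun i => ih (N - outer ℂ (v i))
    refine ⟨∑ i, algebraMap ℝ ℂ (w i) * β i, fun t => ?_⟩
    simp only [expectedDet]
    rw [Finset.mul_sum, ← Finset.sum_add_distrib]
    refine Finset.sum_congr rfl fun i _ => ?_
    rw [add_sub_right_comm, hβ]
    ring

/-- Along `N + t u uᵀ` the expectation is affine in `t` without zeros in `Im t ≥ 0`. Its zero, if
any, is `1 / q`, so `Im (1 / q) < 0` and `Im q > 0`. -/
theorem exists_expectedDet_sub_outer_eq (w : ι → ℝ) (v : ι → d → ℝ) (l : ℕ)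
    (h : ∀ N : Matrix d d ℂ, ImPosDef N → expectedDet w v l N ≠ 0)
    {N : Matrix d d ℂ} (hN : ImPosDef N) (u : d → ℝ) :
    ∃ q : ℂ, (q = 0 ∨ 0 < q.im) ∧
      expectedDet w v l (N - outer ℂ u) = expectedDet w v l N * (1 + q) := by
  obtain ⟨β, hβ⟩ := expectedDet_affine w v u l N
  have hα := h N hN
  set α := expectedDet w v l N with hαdef
  refine ⟨-(β / α), ?_, ?_⟩
  · by_contra! hc
    obtain ⟨h1, h2⟩ := hc
    have hβ0 : β ≠ 0 := by rintro rfl; simp at h1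
    have hz : β / α ≠ 0 := div_ne_zero hβ0 hα
    have ht : 0 ≤ (-(β / α)⁻¹).im := by
      rw [Complex.neg_im] at h2 ⊢
      rw [Complex.inv_im, neg_div, neg_neg]
      exact div_nonneg (by linarith) (Complex.normSq_nonneg _)
    refine h _ (hN.add_smul_outer u ht) ?_
    rw [hβ]
    field_simp
    ring
  · have := hβ (-1)
    rw [neg_one_smul, ← sub_eq_add_neg] at this
    rw [this]
    field_simp

/-- One more draw multiplies the expectation by `1 + ∑ w i q i`. Were this zero, all `w i q i` would
have imaginary part zero, hence vanish, leaving `1 = 0`. -/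
theorem ImPosDef.expectedDet_ne_zero (w : ι → ℝ) (v : ι → d → ℝ) (hw0 : ∀ i, 0 ≤ w i)
    (hw : ∑ i, w i = 1) (l : ℕ) {N : Matrix d d ℂ} (hN : ImPosDef N) :
    expectedDet w v l N ≠ 0 := by
  induction l generalizing N with
  | zero => exact hN.det_ne_zero
  | succ l ih =>
    choose q hq hq' using
      fun i => exists_expectedDet_sub_outer_eq w v l (fun N hN => ih hN) hN (v i)
    have hsum : expectedDet w v (l + 1) N
        = expectedDet w v l N * (1 + ∑ i, (w i : ℂ) * q i) := by
      have h1 : (1 : ℂ) = ∑ i, (w i : ℂ) := by rw [← Complex.ofReal_sum, hw, Complex.ofReal_one]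
      conv_rhs => rw [h1]
      rw [← Finset.sum_add_distrib, Finset.mul_sum]
      simp only [expectedDet, hq']
      refine Finset.sum_congr rfl fun i _ => ?_
      rw [Complex.coe_algebraMap]
      ring
    rw [hsum]
    refine mul_ne_zero (ih hN) fun h0 => ?_
    have him : ∑ i, w i * (q i).im = 0 := by
      have := congrArg Complex.im h0
      simpa [Complex.im_sum] using this
    have hq0 : ∀ i, 0 ≤ (q i).im := fun i => by
      rcases hq i with h | h
      · simp [h]
      · exact h.le
    have hz : ∀ i, (w i : ℂ) * q i = 0 := fun i => by
      have := (Finset.sum_eq_zero_iff_of_nonneg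
        (fun i _ => mul_nonneg (hw0 i) (hq0 i))).1 him i (Finset.mem_univ i)
      rcases mul_eq_zero.1 this with h | h
      · simp [h]
      · rcases hq i with h' | h'
        · simp [h']
        · exact absurd h h'.ne'
    simp [hz] at h0

theorem ImPosDef.im_expectedDet_div_nonneg (w : ι → ℝ) (v : ι → d → ℝ) (hw0 : ∀ i, 0 ≤ w i)
    (hw : ∑ i, w i = 1) (l : ℕ) {N : Matrix d d ℂ} (hN : ImPosDef N) (u : d → ℝ) :
    0 ≤ (expectedDet w v l (N - outer ℂ u) / expectedDet w v l N).im := by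
  obtain ⟨q, hq, hq'⟩ := exists_expectedDet_sub_outer_eq w v l
    (fun N hN => hN.expectedDet_ne_zero w v hw0 hw l) hN u
  rw [hq', mul_div_cancel_left₀ _ (hN.expectedDet_ne_zero w v hw0 hw l)]
  rcases hq with h | h
  · simp [h]
  · simpa using h.le

end

/-! ### Gram matrices and their expected characteristic polynomials. -/

section

variable {ι d : Type*}

/-- The matrix whose columns are the vectors `v i` with `i` in the list `L`. -/
def listCols (v : ι → d → ℝ) (L : List ι) : Matrix d (Fin L.length) ℝ :=
  of fun a j => v (L.get j) a

theorem listCols_cons_mul_transpose (v : ι → d → ℝ) (i : ι) (L : List ι) :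
    listCols v (i :: L) * (listCols v (i :: L))ᵀ
      = outer ℝ (v i) + listCols v L * (listCols v L)ᵀ := by
  ext a b
  simp [listCols, mul_apply, outer, vecMulVec_apply, Fin.sum_univ_succ]

theorem posSemidef_listCols [Fintype d] (v : ι → d → ℝ) (L : List ι) :
    ((listCols v L)ᵀ * listCols v L).PosSemidef := by
  simpa using posSemidef_conjTranspose_mul_self (listCols v L)

variable [Fintype d] [DecidableEq d]

/-- The matrix `z - ∑ v vᵀ`, the sum running over the vectors indexed by a list. -/
def scalarSubOuter {R : Type*} [CommRing R] [Algebra ℝ R] (z : R) (v : ι → d → ℝ) :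
    List ι → Matrix d d R
  | [] => scalar d z
  | i :: L => scalarSubOuter z v L - outer R (v i)

theorem scalarSubOuter_map {R S : Type*} [CommRing R] [Algebra ℝ R] [CommRing S] [Algebra ℝ S]
    (f : R →ₐ[ℝ] S) (z : R) (v : ι → d → ℝ) (L : List ι) :
    (scalarSubOuter z v L).map f = scalarSubOuter (f z) v L := by
  induction L with
  | nil => ext a b; simp [scalarSubOuter, diagonal_apply, apply_ite f]
  | cons i L ih => rw [scalarSubOuter, Matrix.map_sub _ (map_sub f), ih, outer_map]; rfl

theorem charmatrix_listCols (v : ι → d → ℝ) (L : List ι) :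
    charmatrix (listCols v L * (listCols v L)ᵀ) = scalarSubOuter X v L := by
  induction L with
  | nil => ext a b; simp [charmatrix, scalarSubOuter]
  | cons i L ih =>
    rw [listCols_cons_mul_transpose, scalarSubOuter, ← ih]
    ext a b : 1
    rw [Matrix.sub_apply]
    simp only [charmatrix_apply, Matrix.add_apply, C_add, outer, vecMulVec_apply,
      Function.comp_apply, algebraMap_eq, Algebra.algebraMap_self, RingHom.id_apply, C_mul]
    ring

theorem imPosDef_scalarSubOuter {z : ℂ} (hz : 0 < z.im) (v : ι → d → ℝ) (L : List ι) :
    ImPosDef (scalarSubOuter z v L) := by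
  induction L with
  | nil =>
    intro x hx
    have h : star x ⬝ᵥ scalar d z *ᵥ x = z * ((∑ a, Complex.normSq (x a) : ℝ) : ℂ) := by
      simp only [dotProduct, scalar_apply, mulVec_diagonal, Complex.ofReal_sum, Finset.mul_sum]
      refine Finset.sum_congr rfl fun a _ => ?_
      rw [Complex.normSq_eq_conj_mul_self, Pi.star_apply, ← starRingEnd_apply]
      ring
    rw [scalarSubOuter, h, Complex.im_mul_ofReal]
    refine mul_pos hz ?_
    obtain ⟨a, ha⟩ := Function.ne_iff.1 hx
    exact Finset.sum_pos' (fun a _ => Complex.normSq_nonneg _)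
      ⟨a, Finset.mem_univ a, Complex.normSq_pos.2 ha⟩
  | cons i L ih => exact ih.sub_outer _

variable [Fintype ι]

/-- The expectation of `det (G - X)`, where `G` is the Gram matrix of the vectors indexed by the
list `L` and `l` further independent vectors, each equal to `v i` with weight `w i`. -/
noncomputable def expectedGramPoly (w : ι → ℝ) (v : ι → d → ℝ) : ℕ → List ι → ℝ[X]
  | 0, L => (-1) ^ L.length * ((listCols v L)ᵀ * listCols v L).charpoly
  | l + 1, L => ∑ i, C (w i) * expectedGramPoly w v l (i :: L)

/-- `VᵀV` and `VVᵀ` have the same characteristic polynomial up to a power of `X`. This moves from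
Gram matrices, which grow with the list, to matrices of fixed size, where a draw is a rank one
update. -/
theorem X_pow_mul_expectedGramPoly (w : ι → ℝ) (v : ι → d → ℝ) (l : ℕ) (L : List ι) :
    X ^ Fintype.card d * expectedGramPoly w v l L
      = (-X) ^ (l + L.length) * expectedDet w v l (scalarSubOuter X v L) := by
  induction l generalizing L with
  | zero =>
    have h := charpoly_mul_comm' (listCols v L)ᵀ (listCols v L)
    rw [Fintype.card_fin, charpoly, charpoly, charmatrix_listCols] at h
    rw [expectedGramPoly, expectedDet, charpoly, mul_left_comm, h, zero_add,
      neg_pow (X : ℝ[X]), mul_assoc]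
  | succ l ih =>
    rw [expectedGramPoly, expectedDet, Finset.mul_sum, Finset.mul_sum]
    refine Finset.sum_congr rfl fun i _ => ?_
    rw [mul_left_comm, ih, List.length_cons, scalarSubOuter, algebraMap_eq, mul_left_comm,
      add_right_comm, ← add_assoc]

theorem expectedGramPoly_swap (w : ι → ℝ) (v : ι → d → ℝ) (l : ℕ) (i j : ι) (L : List ι) :
    expectedGramPoly w v l (i :: j :: L) = expectedGramPoly w v l (j :: i :: L) := by
  refine mul_left_cancel₀ (pow_ne_zero (Fintype.card d) X_ne_zero) ?_
  rw [X_pow_mul_expectedGramPoly, X_pow_mul_expectedGramPoly]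
  simp only [List.length_cons, scalarSubOuter, sub_right_comm]

theorem eval_expectedGramPoly_zero (w : ι → ℝ) (v : ι → d → ℝ) (L : List ι) (x : ℝ) :
    (expectedGramPoly w v 0 L).eval x
      = ((listCols v L)ᵀ * listCols v L - scalar _ x).det := by
  rw [expectedGramPoly, eval_mul, eval_charpoly, ← neg_sub, det_neg, Fintype.card_fin]
  simp [← mul_assoc, ← mul_pow]

theorem expectedGramPoly_pos (w : ι → ℝ) (v : ι → d → ℝ) (hw0 : ∀ i, 0 ≤ w i)
    (hw : ∑ i, w i = 1) (l : ℕ) (L : List ι) {x : ℝ} (hx : x < 0) :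
    0 < (expectedGramPoly w v l L).eval x := by
  induction l generalizing L with
  | zero =>
    rw [eval_expectedGramPoly_zero, sub_eq_add_neg]
    refine PosDef.det_pos (PosDef.posSemidef_add (posSemidef_listCols v L) ?_)
    have : -(scalar (Fin L.length)) x = diagonal fun _ => -x := by
      ext a b; simp [diagonal_apply]; split_ifs <;> simp
    rw [this]
    exact PosDef.diagonal fun _ => by simpa using hx
  | succ l ih =>
    obtain ⟨i, -, hi⟩ := Finset.exists_ne_zero_of_sum_ne_zero (hw ▸ one_ne_zero)
    rw [expectedGramPoly, eval_finsetSum]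
    simp only [eval_mul, eval_C]
    exact Finset.sum_pos' (fun i _ => mul_nonneg (hw0 i) (ih _).le)
      ⟨i, Finset.mem_univ i, mul_pos ((hw0 i).lt_of_ne' hi) (ih _)⟩

theorem expectedGramPoly_nonneg_at_zero (w : ι → ℝ) (v : ι → d → ℝ) (hw0 : ∀ i, 0 ≤ w i)
    (l : ℕ) (L : List ι) : 0 ≤ (expectedGramPoly w v l L).eval 0 := by
  induction l generalizing L with
  | zero =>
    rw [eval_expectedGramPoly_zero, map_zero, sub_zero]
    exact (posSemidef_listCols v L).det_nonneg
  | succ l ih =>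
    rw [expectedGramPoly, eval_finsetSum]
    simp only [eval_mul, eval_C]
    exact Finset.sum_nonneg fun i _ => mul_nonneg (hw0 i) (ih _)

/-- The value at `0` averages nonnegative Gram determinants. If it is zero, every draw of positive
weight is linearly dependent, and stays so with another vector added. -/
theorem expectedGramPoly_cons_eval_zero (w : ι → ℝ) (v : ι → d → ℝ) (hw0 : ∀ i, 0 ≤ w i)
    (l : ℕ) (i : ι) (L : List ι) (h : (expectedGramPoly w v l L).eval 0 = 0) :
    (expectedGramPoly w v l (i :: L)).eval 0 = 0 := by
  induction l generalizing L with
  | zero =>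
    rw [eval_expectedGramPoly_zero, map_zero, sub_zero] at h ⊢
    obtain ⟨c, hc, hc0⟩ := exists_mulVec_eq_zero_iff.2 h
    have h1 : listCols v L *ᵥ c = 0 := by
      have := conjTranspose_mul_self_mulVec_eq_zero (listCols v L) c
      rw [conjTranspose_eq_transpose_of_trivial] at this
      exact this.1 hc0
    have h2 : listCols v (i :: L) *ᵥ (Fin.cons 0 c : Fin (L.length + 1) → ℝ) = 0 := by
      rw [← h1]
      ext a
      simp [listCols, mulVec, dotProduct, Fin.sum_univ_succ]
    refine exists_mulVec_eq_zero_iff.1 ⟨(Fin.cons 0 c : Fin (L.length + 1) → ℝ), ?_, ?_⟩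
    · intro h0
      apply hc
      ext j
      simpa using congrFun h0 j.succ
    · exact (mulVec_mulVec _ _ _).symm.trans (by rw [h2, mulVec_zero])
  | succ l ih =>
    rw [expectedGramPoly, eval_finsetSum] at h ⊢
    simp only [eval_mul, eval_C] at h ⊢
    rw [Finset.sum_eq_zero_iff_of_nonneg
      fun i _ => mul_nonneg (hw0 i) (expectedGramPoly_nonneg_at_zero w v hw0 l _)] at h
    refine Finset.sum_eq_zero fun j hj => ?_
    rcases mul_eq_zero.1 (h j hj) with h' | h'
    · rw [h', zero_mul]
    · rw [expectedGramPoly_swap, ih _ h', mul_zero]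

theorem aeval_expectedGramPoly (w : ι → ℝ) (v : ι → d → ℝ) (l : ℕ) (L : List ι) (z : ℂ) :
    z ^ Fintype.card d * aeval z (expectedGramPoly w v l L)
      = (-z) ^ (l + L.length) * expectedDet w v l (scalarSubOuter z v L) := by
  have h := congrArg (aeval z) (X_pow_mul_expectedGramPoly w v l L)
  rw [map_mul, map_mul, expectedDet_map, scalarSubOuter_map] at h
  simpa using h

theorem aeval_expectedGramPoly_ne_zero (w : ι → ℝ) (v : ι → d → ℝ) (hw0 : ∀ i, 0 ≤ w i)
    (hw : ∑ i, w i = 1) (l : ℕ) (L : List ι) {z : ℂ} (hz : 0 < z.im) :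
    aeval z (expectedGramPoly w v l L) ≠ 0 := by
  have hz0 : z ≠ 0 := by rintro rfl; simp at hz
  have h := aeval_expectedGramPoly w v l L z
  intro h0
  rw [h0, mul_zero] at h
  exact mul_ne_zero (pow_ne_zero _ (neg_ne_zero.2 hz0))
    ((imPosDef_scalarSubOuter hz v L).expectedDet_ne_zero w v hw0 hw l) h.symm

theorem im_expectedGramPoly_cons_div_nonneg (w : ι → ℝ) (v : ι → d → ℝ) (hw0 : ∀ i, 0 ≤ w i)
    (hw : ∑ i, w i = 1) (l : ℕ) (i : ι) (L : List ι) {z : ℂ} (hz : 0 < z.im) :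
    0 ≤ (-(aeval z (expectedGramPoly w v l (i :: L))
      / (z * aeval z (expectedGramPoly w v l L)))).im := by
  have hz0 : z ≠ 0 := by rintro rfl; simp at hz
  have h1 := aeval_expectedGramPoly w v l L z
  have h2 := aeval_expectedGramPoly w v l (i :: L) z
  have h3 := (imPosDef_scalarSubOuter hz v L).im_expectedDet_div_nonneg w v hw0 hw l (v i)
  have h4 := (imPosDef_scalarSubOuter hz v L).expectedDet_ne_zero w v hw0 hw l
  have h5 := aeval_expectedGramPoly_ne_zero w v hw0 hw l L hz
  convert h3 using 2
  rw [List.length_cons, ← add_assoc, pow_succ, scalarSubOuter] at h2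
  rw [neg_eq_iff_eq_neg, div_eq_iff (mul_ne_zero hz0 h5)]
  refine mul_left_cancel₀ (pow_ne_zero (Fintype.card d) hz0) ?_
  rw [h2]
  have : z ^ Fintype.card d * (-(expectedDet w v l (scalarSubOuter z v L - outer ℂ (v i))
      / expectedDet w v l (scalarSubOuter z v L)) * (z * aeval z (expectedGramPoly w v l L)))
      = -(expectedDet w v l (scalarSubOuter z v L - outer ℂ (v i))
      / expectedDet w v l (scalarSubOuter z v L)) * z
        * (z ^ Fintype.card d * aeval z (expectedGramPoly w v l L)) := by ring
  rw [this, h1]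
  field_simp

end

/-! ### From the half-plane inequality to the choice of a column. -/

section

open Set Filter Topology

/-- `Im (p · conj g)` at `x + i y` is nonpositive for `y > 0` and zero at `y = 0`; its right
derivative there is this Wronskian. No division by `g x` occurs, so real zeros of `g` are harmless.
-/
theorem derivative_mul_sub_nonpos_of_im_div {p g : ℝ[X]}
    (h : ∀ z : ℂ, 0 < z.im → aeval z g ≠ 0 ∧ 0 ≤ (-(aeval z p / aeval z g)).im) (x : ℝ) :
    (derivative p).eval x * g.eval x - p.eval x * (derivative g).eval x ≤ 0 := by
  let c : ℝ → ℂ := fun y => x + y * Complex.I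
  have hc : HasDerivAt c Complex.I 0 := by
    have := ((hasDerivAt_id (0 : ℝ)).ofReal_comp.mul_const Complex.I).const_add (x : ℂ)
    rw [Complex.ofReal_one, one_mul] at this
    exact this
  have hc0 : c 0 = x := by simp [c]
  have hq : ∀ q : ℝ[X], HasDerivAt (fun y => aeval (c y) q)
      ((derivative q).eval x * Complex.I) 0 := fun q => by
    have h1 := (q.hasDerivAt_aeval (c 0)).comp (0 : ℝ) hc
    rw [hc0, ← Complex.coe_algebraMap, aeval_algebraMap_apply_eq_algebraMap_eval] at h1
    exact h1
  have ev : ∀ q : ℝ[X], aeval (c 0) q = ((q.eval x : ℝ) : ℂ) := fun q => by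
    rw [hc0, ← Complex.coe_algebraMap, aeval_algebraMap_apply_eq_algebraMap_eval]
  have hF := Complex.imCLM.hasFDerivAt.comp_hasDerivAt (0 : ℝ) ((hq p).mul (hq g).star)
  have hlim := hF.tendsto_slope_zero_right
  have hle := le_of_tendsto hlim (b := 0) ?_
  · simp only [ev] at hle
    simp at hle
    linarith
  · filter_upwards [self_mem_nhdsWithin] with y hy
    have hy' : 0 < y := hy
    obtain ⟨h1, h2⟩ := h (c y) (by simpa [c] using hy')
    have h3 : aeval (c y) p * star (aeval (c y) g)
        = (aeval (c y) p / aeval (c y) g) * (Complex.normSq (aeval (c y) g) : ℂ) := by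
      rw [Complex.normSq_eq_conj_mul_self, ← starRingEnd_apply]
      field_simp
    have h4 : (aeval (c y) p * star (aeval (c y) g)).im ≤ 0 := by
      rw [h3, Complex.im_mul_ofReal]
      rw [Complex.neg_im] at h2
      exact mul_nonpos_of_nonpos_of_nonneg (by linarith) (Complex.normSq_nonneg _)
    have h5 : (aeval (c 0) p * star (aeval (c 0) g)).im = 0 := by
      rw [ev, ev]; simp
    simp only [zero_add, smul_eq_mul, Function.comp_apply, Complex.imCLM_apply, Pi.mul_apply]
    rw [h5, sub_zero]
    exact mul_nonpos_of_nonneg_of_nonpos (by positivity) h4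

theorem antitoneOn_eval_div {p f : ℝ[X]} {s : Set ℝ} (hs : Convex ℝ s)
    (hf : ∀ x ∈ s, f.eval x ≠ 0)
    (h : ∀ x, (derivative p).eval x * f.eval x - p.eval x * (derivative f).eval x ≤ 0) :
    AntitoneOn (fun x => p.eval x / f.eval x) s := by
  have hd : ∀ x ∈ s, HasDerivAt (fun x => p.eval x / f.eval x)
      (((derivative p).eval x * f.eval x - p.eval x * (derivative f).eval x) / f.eval x ^ 2) x :=
    fun x hx => (p.hasDerivAt x).div (f.hasDerivAt x) (hf x hx)
  refine antitoneOn_of_deriv_nonpos hs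
    (fun x hx => (hd x hx).continuousAt.continuousWithinAt)
    (fun x hx => (hd x (interior_subset hx)).differentiableAt.differentiableWithinAt)
    fun x hx => ?_
  rw [(hd x (interior_subset hx)).deriv]
  exact div_nonpos_of_nonpos_of_nonneg (h x) (sq_nonneg _)

/-- `x f / p` is increasing on `(-∞, b]` and zero at `0`, so `f ≥ 0` to the right of `0`. A zero of
`f` there would force `f` to vanish on a whole interval. -/
theorem eval_pos_of_derivative_mul_sub_nonpos {p f : ℝ[X]} {b : ℝ}
    (h : ∀ x, (derivative p).eval x * (X * f).eval x
      - p.eval x * (derivative (X * f)).eval x ≤ 0)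
    (hp : ∀ x ≤ b, 0 < p.eval x) (hf : ∀ x < 0, 0 < f.eval x) (hf0 : 0 < f.eval 0) :
    ∀ x ≤ b, 0 < f.eval x := by
  intro x hx
  rcases lt_trichotomy x 0 with hx0 | rfl | hx0
  · exact hf x hx0
  · exact hf0
  have hanti : AntitoneOn (fun x => (-(X * f)).eval x / p.eval x) (Iic b) := by
    refine antitoneOn_eval_div (convex_Iic b) (fun x hx => (hp x hx).ne') fun x => ?_
    have := h x
    rw [derivative_neg, eval_neg, eval_neg]
    linarith
  have h0b : (0 : ℝ) ∈ Iic b := hx0.le.trans hx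
  have key : ∀ y, 0 ≤ y → y ≤ x → 0 ≤ y * f.eval y / p.eval y := fun y hy hyx => by
    have := hanti h0b (hyx.trans hx : y ∈ Iic b) hy
    simp only [eval_neg, eval_mul, eval_X, zero_mul, neg_zero, zero_div, neg_div] at this
    linarith
  have hnn : 0 ≤ f.eval x := by
    have := key x hx0.le le_rfl
    by_contra! hneg
    exact absurd this (not_le.2 (div_neg_of_neg_of_pos (mul_neg_of_pos_of_neg hx0 hneg) (hp x hx)))
  refine hnn.lt_of_ne' fun hz => ?_
  have hzero : ∀ y ∈ Ioo 0 x, f.eval y = 0 := fun y hy => by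
    have h1 := hanti (hy.2.le.trans hx : y ∈ Iic b) (hx : x ∈ Iic b) hy.2.le
    simp only [eval_neg, eval_mul, eval_X, hz, mul_zero, neg_zero, zero_div, neg_div] at h1
    have h2 := key y hy.1.le hy.2.le
    have h3 : y * f.eval y / p.eval y = 0 := by linarith
    have h4 := (hp y (hy.2.le.trans hx)).ne'
    have h5 := hy.1.ne'
    simpa [h4, h5] using h3
  have : f = 0 := f.eq_zero_of_infinite_isRoot ((Ioo_infinite hx0).mono hzero)
  simp [this] at hf0

/-- On `(0, b]` the ratio `p / (x f)` decreases to a positive value at `b`, so it is positive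
throughout. -/
theorem eval_pos_of_interlaces {p f : ℝ[X]} {b : ℝ} (hb : 0 < b)
    (h : ∀ z : ℂ, 0 < z.im → aeval z f ≠ 0 ∧ 0 ≤ (-(aeval z p / (z * aeval z f))).im)
    (hf : ∀ x ≤ b, 0 < f.eval x) (hp : ∀ x < 0, 0 < p.eval x) (hp0 : 0 ≤ p.eval 0)
    (hpb : 0 < p.eval b) : ∀ x ≤ b, 0 < p.eval x := by
  intro x hx
  rcases lt_trichotomy x 0 with hx0 | rfl | hx0
  · exact hp x hx0
  · refine hp0.lt_of_ne' fun hz => ?_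
    -- If `p 0 = 0`, the factor `x` cancels and `R / f` decreases on all of `(-∞, b]`, yet it is
    -- negative at `-1` and positive at `b`.
    obtain ⟨R, rfl⟩ : X ∣ p := by rwa [X_dvd_iff, coeff_zero_eq_eval_zero]
    have hR := antitoneOn_eval_div (convex_Iic b) (fun x hx => (hf x hx).ne')
      (derivative_mul_sub_nonpos_of_im_div (p := R) (g := f) fun z hz => by
        obtain ⟨h1, h2⟩ := h z hz
        have hz0 : z ≠ 0 := by rintro rfl; simp at hz
        refine ⟨h1, ?_⟩
        rwa [map_mul, aeval_X, mul_div_mul_left _ _ hz0] at h2)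
    have h1 := hR (by simp; linarith : (-1 : ℝ) ∈ Iic b) (mem_Iic.2 le_rfl) (by linarith)
    have h2 := hp (-1) (by norm_num)
    rw [eval_mul, eval_X] at h2 hpb
    have h3 : 0 < R.eval b / f.eval b := div_pos (pos_of_mul_pos_right hpb hb.le) (hf b le_rfl)
    have h4 : R.eval (-1) / f.eval (-1) < 0 :=
      div_neg_of_neg_of_pos (by linarith) (hf _ (by linarith))
    simp only at h1
    linarith
  · have hR := antitoneOn_eval_div (p := p) (f := X * f) (convex_Ioc 0 b) (fun x hx => by
        rw [eval_mul, eval_X]; exact (mul_pos hx.1 (hf x hx.2)).ne')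
      (derivative_mul_sub_nonpos_of_im_div fun z hz => by
        obtain ⟨h1, h2⟩ := h z hz
        have hz0 : z ≠ 0 := by rintro rfl; simp at hz
        rw [map_mul, aeval_X]
        exact ⟨mul_ne_zero hz0 h1, h2⟩)
    have h1 := hR (⟨hx0, hx⟩ : x ∈ Ioc 0 b) ⟨hb, le_rfl⟩ hx
    simp only [eval_mul, eval_X] at h1
    have h3 : 0 < p.eval b / (b * f.eval b) := div_pos hpb (mul_pos hb (hf b le_rfl))
    by_contra! hneg
    have h4 : p.eval x / (x * f.eval x) ≤ 0 :=
      div_nonpos_of_nonpos_of_nonneg hneg (mul_pos hx0 (hf x hx)).le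
    linarith

section

variable {ι d : Type*} [Fintype ι] [Fintype d]

theorem exists_expectedGramPoly_cons_pos (w : ι → ℝ) (v : ι → d → ℝ) (hw0 : ∀ i, 0 ≤ w i)
    (hw : ∑ i, w i = 1) (l : ℕ) (L : List ι) {b : ℝ} (hb : 0 < b)
    (h : ∀ x ≤ b, 0 < (expectedGramPoly w v (l + 1) L).eval x) :
    ∃ i, ∀ x ≤ b, 0 < (expectedGramPoly w v l (i :: L)).eval x := by
  classical
  have hq : ∀ z : ℂ, 0 < z.im → aeval z (expectedGramPoly w v l L) ≠ 0 :=
    fun z hz => aeval_expectedGramPoly_ne_zero w v hw0 hw l L hz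
  have heval : ∀ x, (expectedGramPoly w v (l + 1) L).eval x
      = ∑ i, w i * (expectedGramPoly w v l (i :: L)).eval x := fun x => by
    simp [expectedGramPoly, eval_finsetSum]
  have hf : ∀ x ≤ b, 0 < (expectedGramPoly w v l L).eval x := by
    refine eval_pos_of_derivative_mul_sub_nonpos (derivative_mul_sub_nonpos_of_im_div
      (p := expectedGramPoly w v (l + 1) L) fun z hz => ?_) h
      (fun x hx => expectedGramPoly_pos w v hw0 hw l L hx)
      ((expectedGramPoly_nonneg_at_zero w v hw0 l L).lt_of_ne' fun h0 => ?_)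
    · have hz0 : z ≠ 0 := by rintro rfl; simp at hz
      rw [map_mul, aeval_X]
      refine ⟨mul_ne_zero hz0 (hq z hz), ?_⟩
      have : -(aeval z (expectedGramPoly w v (l + 1) L) / (z * aeval z (expectedGramPoly w v l L)))
          = ∑ i, (w i : ℂ) * (-(aeval z (expectedGramPoly w v l (i :: L))
            / (z * aeval z (expectedGramPoly w v l L)))) := by
        simp only [expectedGramPoly, map_sum, map_mul, aeval_C, Complex.coe_algebraMap,
          Finset.sum_div, ← Finset.sum_neg_distrib, mul_neg, mul_div_assoc]
      rw [this, Complex.im_sum]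
      refine Finset.sum_nonneg fun i _ => ?_
      rw [Complex.im_ofReal_mul]
      exact mul_nonneg (hw0 i) (im_expectedGramPoly_cons_div_nonneg w v hw0 hw l i L hz)
    · have := h 0 hb.le
      rw [heval] at this
      simp [expectedGramPoly_cons_eval_zero w v hw0 l _ L h0] at this
  have hb' := h b le_rfl
  rw [heval] at hb'
  obtain ⟨i, -, hi⟩ := Finset.exists_lt_of_sum_lt (s := Finset.univ) (f := fun _ => (0 : ℝ))
    (by simpa using hb')
  refine ⟨i, eval_pos_of_interlaces hb (fun z hz => ⟨hq z hz,
    im_expectedGramPoly_cons_div_nonneg w v hw0 hw l i L hz⟩) hf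
    (fun x hx => expectedGramPoly_pos w v hw0 hw l _ hx)
    (expectedGramPoly_nonneg_at_zero w v hw0 l _) (pos_of_mul_pos_right hi (hw0 i))⟩

theorem exists_list_expectedGramPoly_pos (w : ι → ℝ) (v : ι → d → ℝ) (hw0 : ∀ i, 0 ≤ w i)
    (hw : ∑ i, w i = 1) {b : ℝ} (hb : 0 < b) (l : ℕ) (L : List ι)
    (h : ∀ x ≤ b, 0 < (expectedGramPoly w v l L).eval x) :
    ∃ L' : List ι, L'.length = l + L.length ∧
      ∀ x ≤ b, 0 < (expectedGramPoly w v 0 L').eval x := by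
  induction l generalizing L with
  | zero => exact ⟨L, by simp, h⟩
  | succ l ih =>
    obtain ⟨i, hi⟩ := exists_expectedGramPoly_cons_pos w v hw0 hw l L hb h
    obtain ⟨L', h1, h2⟩ := ih _ hi
    exact ⟨L', by rw [h1, List.length_cons]; omega, h2⟩

end

end

/-! ### The barrier argument for `1 - μ D`. -/

section

variable {κ K : Type*} [Fintype κ] [Field K]

theorem eval_derivative_prod_X_sub_C (r : κ → K) {x : K} (hx : ∀ i, x ≠ r i) :
    (derivative (∏ i, (X - C (r i)))).eval x
      = (∏ i, (X - C (r i))).eval x * ∑ i, 1 / (x - r i) := by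
  classical
  rw [derivative_prod_finset, eval_finsetSum, Finset.mul_sum]
  refine Finset.sum_congr rfl fun i _ => ?_
  rw [← Finset.prod_erase_mul _ _ (Finset.mem_univ i)]
  have := sub_ne_zero.2 (hx i)
  simp only [derivative_sub, derivative_X, derivative_C, sub_zero, mul_one, eval_mul, eval_sub,
    eval_X, eval_C]
  field_simp

theorem eval_derivative_derivative_prod_X_sub_C (r : κ → K) {x : K} (hx : ∀ i, x ≠ r i) :
    (derivative (derivative (∏ i, (X - C (r i))))).eval x
      = (∏ i, (X - C (r i))).eval x
        * ((∑ i, 1 / (x - r i)) ^ 2 - ∑ i, 1 / (x - r i) ^ 2) := by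
  classical
  have h1 : ∀ s : Finset κ, (derivative (∏ i ∈ s, (X - C (r i)))).eval x
      = (∏ i ∈ s, (X - C (r i))).eval x * ∑ i ∈ s, 1 / (x - r i) := fun s => by
    have := eval_derivative_prod_X_sub_C (fun i : s => r i) (x := x) fun i => hx i
    rwa [Finset.prod_coe_sort s fun i => X - C (r i),
      Finset.sum_coe_sort s fun i => 1 / (x - r i)] at this
  induction (Finset.univ : Finset κ) using Finset.induction_on with
  | empty => simp
  | insert a s ha ih =>
    have := sub_ne_zero.2 (hx a)
    rw [Finset.prod_insert ha, Finset.sum_insert ha, Finset.sum_insert ha]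
    simp only [derivative_mul, derivative_add, derivative_sub, derivative_X, derivative_C,
      sub_zero, one_mul, eval_add, eval_mul, ih, h1, eval_sub, eval_X, eval_C]
    field_simp
    ring

end

/-- A real polynomial without nonreal roots splits. -/
theorem splits_of_aeval_ne_zero {q : ℝ[X]} (h : ∀ z : ℂ, z.im ≠ 0 → aeval z q ≠ 0) :
    q.Splits := by
  refine (IsAlgClosed.splits (q.map (algebraMap ℝ ℂ))).of_splits_map _ fun z hz => ?_
  have hz0 : aeval z q = 0 := by
    rw [← eval_map_algebraMap]
    exact isRoot_of_mem_roots hz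
  have him : z.im = 0 := by
    by_contra hc
    exact h z hc hz0
  exact ⟨z.re, Complex.ext (by simp) (by simp [him])⟩

theorem exists_eq_prod_X_sub_C {q : ℝ[X]} {k : ℕ} (hs : q.Splits) (hm : q.Monic)
    (hd : q.natDegree = k) : ∃ r : Fin k → ℝ, q = ∏ i, (X - C (r i)) := by
  subst hd
  have hlen : q.roots.toList.length = q.natDegree := by
    rw [Multiset.length_toList, hs.natDegree_eq_card_roots]
  refine ⟨fun i => q.roots.toList.get (i.cast hlen.symm), ?_⟩
  conv_lhs => rw [hs.eq_prod_roots_of_monic hm, ← Multiset.coe_toList q.roots]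
  rw [Multiset.map_coe, Multiset.prod_coe]
  rw [← Fin.prod_univ_fun_getElem]
  exact (Fintype.prod_equiv (finCongr hlen.symm) _ _ fun i => rfl).symm

/-- A nonreal zero `z` would satisfy `μ ∑ 1 / (z - r i) = 1`, but the imaginary parts of the
summands all have the same strict sign. -/
theorem splits_sub_derivative {k : ℕ} (r : Fin k → ℝ) (μ : ℝ) :
    ((∏ i, (X - C (r i))) - C μ * derivative (∏ i, (X - C (r i)))).Splits := by
  refine splits_of_aeval_ne_zero fun z hz => ?_
  have hzr : ∀ i, z ≠ (r i : ℂ) := fun i h => hz (by rw [h, Complex.ofReal_im])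
  have hmap : (∏ i, (X - C (r i))).map (algebraMap ℝ ℂ) = ∏ i, (X - C ((r i : ℝ) : ℂ)) := by
    simp [Polynomial.map_prod]
  have h1 := eval_derivative_prod_X_sub_C (fun i => (r i : ℂ)) hzr
  rw [← eval_map_algebraMap, Polynomial.map_sub, Polynomial.map_mul, ← derivative_map, hmap,
    eval_sub, eval_mul, h1, map_C, eval_C, Complex.coe_algebraMap]
  set P := (∏ i, (X - C ((r i : ℝ) : ℂ))).eval z with hP
  have hP0 : P ≠ 0 := by
    rw [hP, eval_prod]
    exact Finset.prod_ne_zero_iff.2 fun i _ => by simpa using sub_ne_zero.2 (hzr i)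
  intro h0
  have h2 : (μ : ℂ) * ∑ i, 1 / (z - r i) = 1 := by
    refine mul_left_cancel₀ hP0 ?_
    linear_combination -h0
  have h3 : μ * ∑ i, z.im / Complex.normSq (z - r i) = 0 := by
    have := congrArg Complex.im h2
    rw [Complex.im_ofReal_mul, Complex.im_sum] at this
    simpa [Complex.inv_im, neg_div] using this
  rcases mul_eq_zero.1 h3 with h4 | h4
  · simp [h4] at h2
  · simp only [div_eq_mul_inv, ← Finset.mul_sum] at h4
    have h5 := (mul_eq_zero.1 h4).resolve_left hz
    rw [Finset.sum_eq_zero_iff_of_nonneg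
      fun i _ => inv_nonneg.2 (Complex.normSq_nonneg _)] at h5
    have h6 : IsEmpty (Fin k) := ⟨fun i => by
      have := h5 i (Finset.mem_univ i)
      rw [inv_eq_zero, Complex.normSq_eq_zero, sub_eq_zero] at this
      exact hzr i this⟩
    simp at h2

theorem monic_sub_derivative {k : ℕ} (r : Fin k → ℝ) (μ : ℝ) :
    ((∏ i, (X - C (r i))) - C μ * derivative (∏ i, (X - C (r i)))).Monic ∧
    ((∏ i, (X - C (r i))) - C μ * derivative (∏ i, (X - C (r i)))).natDegree = k := by
  have hm : (∏ i, (X - C (r i))).Monic := monic_prod_of_monic _ _ fun i _ => monic_X_sub_C _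
  have hk : (∏ i, (X - C (r i))).natDegree = k := by
    rw [natDegree_prod_of_monic _ _ fun i _ => monic_X_sub_C _]; simp
  have hlt : (C μ * derivative (∏ i, (X - C (r i)))).degree < (∏ i, (X - C (r i))).degree :=
    by
    rw [← smul_eq_C_mul]
    exact (degree_smul_le _ _).trans_lt (degree_derivative_lt hm.ne_zero)
  exact ⟨hm.sub_of_left hlt, (natDegree_eq_of_degree_eq (degree_sub_eq_left_of_degree_lt hlt)).trans hk⟩

/-- With `s i = r i - b` this says that the potential after the shift, `Φ - μ Ψ / (1 + μ Φ)`, is at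
most `φ`. The key is Cauchy–Schwarz in the form `U² ≤ φ₀ W`, together with `δ φ ≤ 1`. -/
theorem barrier_inequality {k : ℕ} (s : Fin k → ℝ) {φ μ : ℝ} (hμ : 0 ≤ μ)
    (hs : ∀ i, μ / (1 + μ * φ) < s i) (hφ : 0 < φ) (h : ∑ i, 1 / s i ≤ φ) :
    ∑ i, 1 / (s i - μ / (1 + μ * φ)) - φ ≤ μ * (∑ i, 1 / (s i - μ / (1 + μ * φ)) ^ 2)
      / (1 + μ * ∑ i, 1 / (s i - μ / (1 + μ * φ))) := by
  have hden : 0 < 1 + μ * φ := by positivity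
  obtain rfl | hμ0 := hμ.eq_or_lt
  · simpa using h
  set δ := μ / (1 + μ * φ) with hδ
  have hδ0 : 0 < δ := by positivity
  have ht : ∀ i, 0 < s i - δ := fun i => sub_pos.2 (hs i)
  have hs0 : ∀ i, 0 < s i := fun i => hδ0.trans (hs i)
  set Φ := ∑ i, 1 / (s i - δ) with hΦ
  set Ψ := ∑ i, 1 / (s i - δ) ^ 2 with hΨ
  set φ₀ := ∑ i, 1 / s i with hφ₀
  set U := ∑ i, 1 / (s i * (s i - δ)) with hU
  set W := ∑ i, 1 / (s i * (s i - δ) ^ 2) with hW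
  have hΦ0 : 0 ≤ Φ := Finset.sum_nonneg fun i _ => one_div_nonneg.2 (ht i).le
  have hU0 : 0 ≤ U := Finset.sum_nonneg fun i _ =>
    one_div_nonneg.2 (mul_pos (hs0 i) (ht i)).le
  have hW0 : 0 ≤ W := Finset.sum_nonneg fun i _ =>
    one_div_nonneg.2 (mul_pos (hs0 i) (pow_pos (ht i) 2)).le
  have h1 : Φ - φ₀ = δ * U := by
    rw [hΦ, hφ₀, hU, ← Finset.sum_sub_distrib, Finset.mul_sum]
    refine Finset.sum_congr rfl fun i _ => ?_
    have := (ht i).ne'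
    have := (hs0 i).ne'
    field_simp
    ring
  have h2 : Ψ = U + δ * W := by
    rw [hΨ, hU, hW, Finset.mul_sum, ← Finset.sum_add_distrib]
    refine Finset.sum_congr rfl fun i _ => ?_
    have := (ht i).ne'
    have := (hs0 i).ne'
    field_simp
    ring
  have h3 : U ^ 2 ≤ φ₀ * W := by
    refine Finset.sum_sq_le_sum_mul_sum_of_sq_le_mul _
      (fun i _ => one_div_nonneg.2 (hs0 i).le)
      (fun i _ => one_div_nonneg.2 (mul_pos (hs0 i) (pow_pos (ht i) 2)).le) fun i _ => ?_
    have := (ht i).ne'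
    have := (hs0 i).ne'
    exact le_of_eq (by field_simp)
  have h4 : δ * (1 + μ * φ) = μ := div_mul_cancel₀ _ hden.ne'
  have h5 : δ * φ ≤ 1 := by
    rw [hδ, div_mul_eq_mul_div, div_le_one hden]; linarith
  have h6 : δ * U ^ 2 ≤ W := by
    calc δ * U ^ 2 ≤ δ * (φ * W) := by
          refine mul_le_mul_of_nonneg_left (h3.trans ?_) hδ0.le
          exact mul_le_mul_of_nonneg_right h hW0
      _ = (δ * φ) * W := by ring
      _ ≤ 1 * W := mul_le_mul_of_nonneg_right h5 hW0
      _ = W := one_mul W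
  rw [le_div_iff₀ (by positivity)]
  rcases le_total (Φ - φ) 0 with hneg | hpos
  · have hΨ0 : 0 ≤ Ψ := by rw [h2]; positivity
    exact (mul_nonpos_of_nonpos_of_nonneg hneg (by positivity)).trans (by positivity)
  · have h7 : Φ - φ ≤ δ * U := by linarith
    calc (Φ - φ) * (1 + μ * Φ) = (Φ - φ) * (1 + μ * φ + μ * (Φ - φ)) := by ring
      _ ≤ (δ * U) * (1 + μ * φ + μ * (δ * U)) := by gcongr
      _ = (δ * (1 + μ * φ)) * U + μ * (δ * (δ * U ^ 2)) := by ring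
      _ ≤ μ * U + μ * (δ * W) := by rw [h4]; gcongr
      _ = μ * Ψ := by rw [h2]; ring

/-- The lower barrier shift for the operator `1 - μ D`: it moves a lower bound `b` for the roots
to `b + μ / (1 + μ φ)` without increasing the potential `∑ 1 / (r - b)` above `φ`. -/
theorem exists_roots_sub_derivative {k : ℕ} (r : Fin k → ℝ) {b φ μ : ℝ} (hμ : 0 ≤ μ)
    (hφ : 0 < φ) (hb : ∀ i, b < r i) (h : ∑ i, 1 / (r i - b) ≤ φ) :
    ∃ r' : Fin k → ℝ,
      (∏ i, (X - C (r i))) - C μ * derivative (∏ i, (X - C (r i))) = ∏ i, (X - C (r' i)) ∧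
      (∀ i, b + μ / (1 + μ * φ) < r' i) ∧
      ∑ i, 1 / (r' i - (b + μ / (1 + μ * φ))) ≤ φ := by
  obtain ⟨r', hr'⟩ := exists_eq_prod_X_sub_C (splits_sub_derivative r μ)
    (monic_sub_derivative r μ).1 (monic_sub_derivative r μ).2
  have hden : 0 < 1 + μ * φ := by positivity
  have hs : ∀ i, μ / (1 + μ * φ) < r i - b := fun i => by
    have h1 : 0 < r i - b := sub_pos.2 (hb i)
    have h2 : 1 / (r i - b) ≤ φ := (Finset.single_le_sum
      (f := fun i => 1 / (r i - b))
      (fun j _ => one_div_nonneg.2 (sub_pos.2 (hb j)).le) (Finset.mem_univ i)).trans h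
    rw [div_le_iff₀ h1] at h2
    rw [div_lt_iff₀ hden]
    nlinarith
  set y := b + μ / (1 + μ * φ) with hy
  have hyr : ∀ i, y < r i := fun i => by have := hs i; rw [hy]; linarith
  have hneg : ∀ x, (∀ i, x < r i) → ∑ i, 1 / (x - r i) = -∑ i, 1 / (r i - x) := fun x _ => by
    rw [← Finset.sum_neg_distrib]
    refine Finset.sum_congr rfl fun i _ => ?_
    rw [← neg_sub, one_div_neg_eq_neg_one_div]
  have hval : ∀ x, (∀ i, x < r i) → (∏ i, (X - C (r' i))).eval x
      = (∏ i, (X - C (r i))).eval x * (1 + μ * ∑ i, 1 / (r i - x)) := fun x hx => by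
    rw [← hr', eval_sub, eval_mul, eval_C,
      eval_derivative_prod_X_sub_C r fun i => (hx i).ne, hneg x hx]
    ring
  have hp0 : ∀ x, (∀ i, x < r i) → (∏ i, (X - C (r i))).eval x ≠ 0 := fun x hx => by
    rw [eval_prod]
    exact Finset.prod_ne_zero_iff.2 fun i _ => by simpa using (sub_neg.2 (hx i)).ne
  have hpos : ∀ x, (∀ i, x < r i) → 0 < 1 + μ * ∑ i, 1 / (r i - x) := fun x hx => by
    have : 0 ≤ ∑ i, 1 / (r i - x) := Finset.sum_nonneg fun i _ =>
      one_div_nonneg.2 (sub_pos.2 (hx i)).le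
    positivity
  have hlt : ∀ j, y < r' j := fun j => by
    by_contra! hc
    have hx : ∀ i, r' j < r i := fun i => hc.trans_lt (hyr i)
    have h0 : (∏ i, (X - C (r' i))).eval (r' j) = 0 := by
      rw [eval_prod]
      exact Finset.prod_eq_zero (Finset.mem_univ j) (by simp)
    rw [hval _ hx] at h0
    exact mul_ne_zero (hp0 _ hx) (hpos _ hx).ne' h0
  refine ⟨r', hr', hlt, ?_⟩
  have hd := eval_derivative_prod_X_sub_C r' fun i => (hlt i).ne
  have hn' : ∑ i, 1 / (y - r' i) = -∑ i, 1 / (r' i - y) := by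
    rw [← Finset.sum_neg_distrib]
    refine Finset.sum_congr rfl fun i _ => ?_
    rw [← neg_sub, one_div_neg_eq_neg_one_div]
  rw [hval y hyr, ← hr', derivative_sub, derivative_C_mul, eval_sub, eval_mul, eval_C,
    eval_derivative_prod_X_sub_C r fun i => (hyr i).ne,
    eval_derivative_derivative_prod_X_sub_C r fun i => (hyr i).ne, hneg y hyr, hn'] at hd
  have hsq : ∑ i, 1 / (y - r i) ^ 2 = ∑ i, 1 / (r i - y) ^ 2 :=
    Finset.sum_congr rfl fun i _ => by rw [← neg_sub, neg_sq]
  rw [hsq] at hd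
  have hpy := hp0 y hyr
  have hposy := hpos y hyr
  have hineq := barrier_inequality (fun i => r i - b) hμ hs hφ h
  have hsub : ∀ i, r i - b - μ / (1 + μ * φ) = r i - y := fun i => by rw [hy]; ring
  simp only [hsub] at hineq
  rw [le_div_iff₀ hposy] at hineq
  set P := (∏ i, (X - C (r i))).eval y
  set Φ := ∑ i, 1 / (r i - y)
  set Ψ := ∑ i, 1 / (r i - y) ^ 2
  set Φ' := ∑ i, 1 / (r' i - y)
  -- Logarithmic derivative of `p - μ p' = p (1 + μ Φ)` at `y`.
  have hd' : Φ' * (1 + μ * Φ) = Φ * (1 + μ * Φ) - μ * Ψ := by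
    refine mul_left_cancel₀ hpy ?_
    linear_combination hd
  have : (Φ' - φ) * (1 + μ * Φ) ≤ 0 := by linarith
  have := nonpos_of_mul_nonpos_left this hposy
  linarith

theorem exists_roots_aeval_derivative {κ : Type*} (s : Finset κ) (μ : κ → ℝ)
    (hμ : ∀ i, 0 ≤ μ i) {k : ℕ} (hk : 0 < k) {φ : ℝ} (hφ : 0 < φ) :
    ∃ r : Fin k → ℝ,
      aeval (derivative : Module.End ℝ ℝ[X]) (∏ i ∈ s, (1 - C (μ i) * X)) (X ^ k)
        = ∏ i, (X - C (r i)) ∧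
      (∀ i, -(k / φ) + ∑ i ∈ s, μ i / (1 + μ i * φ) < r i) ∧
      ∑ i, 1 / (r i - (-(k / φ) + ∑ i ∈ s, μ i / (1 + μ i * φ))) ≤ φ := by
  classical
  have hk' : (0 : ℝ) < k := Nat.cast_pos.2 hk
  induction s using Finset.induction_on with
  | empty =>
    refine ⟨0, by simp, fun i => ?_, ?_⟩
    · have : 0 < k / φ := by positivity
      simpa using this
    · simp only [Pi.zero_apply, Finset.sum_empty, add_zero, zero_sub, neg_neg, Finset.sum_const,
        Finset.card_univ, Fintype.card_fin, nsmul_eq_mul, one_div_div]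
      rw [mul_div_cancel₀ _ hk'.ne']
  | insert a s ha ih =>
    obtain ⟨r, h1, h2, h3⟩ := ih
    obtain ⟨r', h1', h2', h3'⟩ := exists_roots_sub_derivative r (hμ a) hφ h2 h3
    rw [Finset.sum_insert ha, add_comm (μ a / _), ← add_assoc]
    refine ⟨r', ?_, h2', h3'⟩
    rw [← h1', ← h1, Finset.prod_insert ha, map_mul, Module.End.mul_apply]
    simp [Algebra.algebraMap_eq_smul_one, smul_eq_C_mul]

/-! ### The closed form of the expected polynomial. -/

theorem eval_zero_one_sub_derivative_pow_X_pow (k j : ℕ) :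
    (((1 - derivative : Module.End ℝ ℝ[X]) ^ k) (X ^ j)).eval 0
      = (-1) ^ j * (k.descFactorial j : ℝ) := by
  induction k generalizing j with
  | zero => cases j <;> simp
  | succ k ih =>
    rw [pow_succ, Module.End.mul_apply, LinearMap.sub_apply, Module.End.one_apply, map_sub,
      eval_sub, ih]
    cases j with
    | zero => simp
    | succ j =>
      rw [derivative_X_pow, Nat.add_sub_cancel, ← smul_eq_C_mul, map_smul, eval_smul, ih,
        Nat.succ_descFactorial_succ]
      rcases le_total j k with hjk | hjk
      · rw [Nat.descFactorial_succ]
        push_cast [Nat.cast_sub hjk]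
        simp only [smul_eq_mul]
        ring
      · rw [Nat.descFactorial_succ, Nat.sub_eq_zero_of_le hjk]
        rcases hjk.eq_or_lt with rfl | hlt
        · push_cast
          simp only [smul_eq_mul]
          ring
        · rw [Nat.descFactorial_of_lt hlt]; simp

/-- A duality between `f(D)` acting on `X ^ k` and `(1 - D) ^ k` acting on a rescaled `f`: on `X ^
j` both sides are `k.descFactorial j * x ^ (k - j)`, or zero if `j > k`. -/
theorem eval_aeval_derivative_X_pow (f : ℝ[X]) (k : ℕ) {x : ℝ} (hx : x ≠ 0) :
    (aeval (derivative : Module.End ℝ ℝ[X]) f (X ^ k)).eval x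
      = x ^ k * (((1 - derivative : Module.End ℝ ℝ[X]) ^ k)
          (f.comp (C (-x⁻¹) * X))).eval 0 := by
  induction f using Polynomial.induction_on' with
  | add p q hp hq =>
    rw [map_add, LinearMap.add_apply, eval_add, hp, hq, add_comp, map_add, eval_add, mul_add]
  | monomial j a =>
    rw [← C_mul_X_pow_eq_monomial, mul_comp, C_comp, X_pow_comp, mul_pow, ← C_pow, map_mul,
      aeval_C, aeval_X_pow, Module.algebraMap_end_eq_smul_id, Module.End.mul_apply,
      LinearMap.smul_apply, LinearMap.id_apply, Module.End.pow_apply,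
      iterate_derivative_X_pow_eq_smul, ← smul_eq_C_mul, ← smul_eq_C_mul, map_smul, map_smul,
      eval_smul, eval_smul, eval_smul, eval_smul, eval_zero_one_sub_derivative_pow_X_pow]
    simp only [eval_pow, eval_X, smul_eq_mul]
    rcases le_or_gt j k with hjk | hjk
    · rw [pow_sub₀ _ hx hjk, neg_pow, inv_pow]
      have : ((-1 : ℝ) ^ j) * (-1) ^ j = 1 := by rw [← mul_pow]; simp
      linear_combination (-a * k.descFactorial j * x ^ k * (x ^ j)⁻¹) * this
    · rw [Nat.descFactorial_of_lt hjk]; simp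

theorem det_one_add_smul_of_charpoly {κ : Type*} [Fintype κ] [DecidableEq κ] {M : Matrix κ κ ℝ}
    {μ : κ → ℝ} (h : M.charpoly = ∏ i, (X - C (μ i))) (t : ℝ) :
    (1 + t • M).det = ∏ i, (1 + t * μ i) := by
  rcases eq_or_ne t 0 with rfl | ht
  · simp
  have h1 := congrArg (eval (-t⁻¹)) h
  rw [eval_charpoly, eval_prod] at h1
  have h2 : 1 + t • M = (-t) • (scalar κ (-t⁻¹) - M) := by
    ext i j
    simp only [Matrix.add_apply, Matrix.smul_apply, Matrix.sub_apply, scalar_apply, smul_eq_mul,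
      one_apply, diagonal_apply]
    split_ifs <;> field_simp <;> ring
  rw [h2, det_smul, h1, ← Finset.card_univ, ← Finset.prod_const, ← Finset.prod_mul_distrib]
  refine Finset.prod_congr rfl fun i _ => ?_
  simp only [eval_sub, eval_X, eval_C]
  field_simp
  ring

section

variable {ι d κ : Type*} [Fintype ι] [Fintype d] [DecidableEq d] [Fintype κ] [DecidableEq κ]

theorem expectedGramPoly_nil_eq (w : ι → ℝ) (v : ι → d → ℝ) (hw : ∑ i, w i = 1)
    (E : Matrix d κ ℝ) (F : Matrix κ d ℝ) (hEF : ∑ i, w i • outer ℝ (v i) = E * F)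
    (μ : κ → ℝ) (hμ : ∀ t : ℝ, (1 + t • (F * E)).det = ∏ i, (1 + t * μ i)) (k : ℕ) :
    expectedGramPoly w v k []
      = C ((-1) ^ k) * aeval (derivative : Module.End ℝ ℝ[X]) (∏ i, (1 - C (μ i) * X))
          (X ^ k) := by
  have key : ∀ x : ℝ, x ≠ 0 → (expectedGramPoly w v k []).eval x
      = (C ((-1) ^ k) * aeval (derivative : Module.End ℝ ℝ[X]) (∏ i, (1 - C (μ i) * X))
          (X ^ k)).eval x := fun x hx => by
    -- Here `x` is a fixed number and the variable is an auxiliary time with `N' = E[v vᵀ]`; time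
    -- `0` gives back the scalar matrix `x`.
    let N : Matrix d d ℝ[X] := scalar d (C x) + (X : ℝ[X]) • (E * F).map C
    have hN : N.map derivative = ∑ i, C (w i) • outer ℝ[X] (v i) := by
      have h1 : N.map derivative = (E * F).map C := by
        ext a b : 1
        simp only [N, Matrix.map_apply, Matrix.add_apply, scalar_apply, Matrix.smul_apply,
          smul_eq_mul, derivative_add, derivative_mul, derivative_X, one_mul, derivative_C,
          mul_zero, add_zero, diagonal_apply]
        split_ifs <;> simp
      rw [h1, ← hEF]
      ext a b : 1
      simp [Matrix.sum_apply, outer, vecMulVec_apply, map_sum]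
    have h1 := expectedDet_eq_iterate w v hw k N hN
    have hdet : N.det = C (x ^ Fintype.card d)
        * (∏ i, (1 - C (μ i) * X)).comp (C (-x⁻¹) * X) := by
      refine Polynomial.funext fun t => ?_
      have h2 : eval t N.det = (x • (1 + (t * x⁻¹) • (E * F))).det := by
        have := (evalRingHom t).map_det N
        rw [coe_evalRingHom] at this
        rw [this]
        congr 1
        ext a b
        simp only [N, RingHom.mapMatrix_apply, Matrix.map_apply, coe_evalRingHom,
          Matrix.add_apply, Matrix.smul_apply, smul_eq_mul, eval_add, eval_mul, eval_X, eval_C,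
          scalar_apply, diagonal_apply, one_apply]
        split_ifs
        · rw [eval_C]; field_simp
        · rw [eval_zero]; field_simp; ring
      rw [h2, det_smul, ← Matrix.smul_mul, det_one_add_mul_comm, Matrix.mul_smul, hμ, eval_mul,
        eval_C, eval_comp, eval_prod]
      congr 1
      refine Finset.prod_congr rfl fun i _ => ?_
      simp
      ring
    have h3 : expectedDet w v k (scalar d x) = eval 0 (expectedDet w v k N) := by
      have := expectedDet_map w v (aeval (0 : ℝ)) k N
      rw [coe_aeval_eq_eval] at this
      rw [this]
      congr 1
      ext a b
      simp only [N, Matrix.map_apply, Matrix.add_apply, Matrix.smul_apply, smul_eq_mul, eval_add,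
        eval_mul, eval_X, zero_mul, add_zero, scalar_apply, diagonal_apply]
      split_ifs <;> simp
    have h4 : x ^ Fintype.card d * (expectedGramPoly w v k []).eval x
        = (-x) ^ k * expectedDet w v k (scalar d x) := by
      have h := congrArg (aeval x) (X_pow_mul_expectedGramPoly w v k [])
      rw [map_mul, map_mul, expectedDet_map, scalarSubOuter_map] at h
      simpa [scalarSubOuter, coe_aeval_eq_eval] using h
    refine mul_left_cancel₀ (pow_ne_zero (Fintype.card d) hx) ?_
    rw [h4, h3, h1, hdet, ← smul_eq_C_mul, map_smul, eval_smul, eval_mul, eval_C,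
      eval_aeval_derivative_X_pow _ _ hx, neg_pow, smul_eq_mul]
    ring
  refine Polynomial.eq_of_infinite_eval_eq _ _ ?_
  exact (Set.Ioi_infinite (0 : ℝ)).mono fun x hx => key x (ne_of_gt hx)

end

/-! ### Choice of the potential and the bound `ε²`. -/

theorem one_div_one_add_le_sum {κ : Type*} [Fintype κ] {μ : κ → ℝ} (hμ : ∀ i, 0 ≤ μ i)
    (h1 : ∑ i, μ i = 1) {φ : ℝ} (hφ : 0 < φ) :
    1 / (1 + φ * ∑ i, μ i ^ 2) ≤ ∑ i, μ i / (1 + μ i * φ) := by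
  have hden : ∀ i, 0 < 1 + μ i * φ := fun i => by have := hμ i; positivity
  have hpos : 0 < 1 + φ * ∑ i, μ i ^ 2 := by
    have : 0 ≤ ∑ i, μ i ^ 2 := Finset.sum_nonneg fun i _ => sq_nonneg _
    positivity
  have h2 : ∑ i, μ i * (1 + μ i * φ) = 1 + φ * ∑ i, μ i ^ 2 := by
    simp only [mul_add, mul_one, Finset.sum_add_distrib, h1, Finset.mul_sum]
    exact congrArg _ (Finset.sum_congr rfl fun i _ => by ring)
  rw [div_le_iff₀ hpos, ← h2]
  have := Finset.sum_sq_le_sum_mul_sum_of_sq_le_mul Finset.univ (r := μ)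
    (f := fun i => μ i / (1 + μ i * φ)) (g := fun i => μ i * (1 + μ i * φ))
    (fun i _ => div_nonneg (hμ i) (hden i).le) (fun i _ => mul_nonneg (hμ i) (hden i).le)
    fun i _ => le_of_eq (by have := (hden i).ne'; field_simp)
  rwa [h1, one_pow] at this

/-- If `(k - 1) ∑ μ² ≤ (1 - ε)²`, then the roots of `∏ (1 - μ i D) X ^ k` exceed `ε²`. -/
theorem exists_roots_gt_sq {κ : Type*} [Fintype κ] {μ : κ → ℝ} (hμ : ∀ i, 0 ≤ μ i)
    (h1 : ∑ i, μ i = 1) {k : ℕ} {ε : ℝ} (hε₀ : 0 < ε) (hε₁ : ε < 1)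
    (hk : k * ∑ i, μ i ^ 2 ≤ (1 - ε) ^ 2) :
    ∃ r : Fin (k + 1) → ℝ,
      aeval (derivative : Module.End ℝ ℝ[X]) (∏ i, (1 - C (μ i) * X)) (X ^ (k + 1))
        = ∏ i, (X - C (r i)) ∧ ∀ i, ε ^ 2 < r i := by
  have hτ : 0 < ∑ i, μ i ^ 2 := by
    obtain ⟨i, -, hi⟩ := Finset.exists_ne_zero_of_sum_ne_zero (h1 ▸ one_ne_zero)
    exact Finset.sum_pos' (fun i _ => sq_nonneg _) ⟨i, Finset.mem_univ i, by positivity⟩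
  set τ := ∑ i, μ i ^ 2 with hτdef
  have main : ∀ φ : ℝ, 0 < φ → ∃ r : Fin (k + 1) → ℝ,
      aeval (derivative : Module.End ℝ ℝ[X]) (∏ i, (1 - C (μ i) * X)) (X ^ (k + 1))
        = ∏ i, (X - C (r i)) ∧ ∀ i, 1 / (1 + φ * τ) - k / φ ≤ r i ∧
          (0 < k → 1 / (1 + φ * τ) - k / φ < r i) := fun φ hφ => by
    obtain ⟨r, hr1, hr2, hr3⟩ :=
      exists_roots_aeval_derivative Finset.univ μ hμ (Nat.succ_pos k) hφ
    have hS := one_div_one_add_le_sum hμ h1 hφ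
    refine ⟨r, hr1, fun i => ?_⟩
    set y := -((k + 1 : ℕ) / φ) + ∑ i, μ i / (1 + μ i * φ) with hy
    -- The gap `1 / φ` between barrier and roots turns the initial cost `(k + 1) / φ` into `k / φ`.
    have hy' : 1 / (1 + φ * τ) - k / φ ≤ y + 1 / φ := by
      rw [hy]; push_cast; rw [add_div]; linarith
    have hi : 0 < r i - y := sub_pos.2 (hr2 i)
    have hle : 1 / (r i - y) ≤ φ := (Finset.single_le_sum (f := fun i => 1 / (r i - y))
      (fun j _ => one_div_nonneg.2 (sub_pos.2 (hr2 j)).le) (Finset.mem_univ i)).trans hr3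
    refine ⟨?_, fun hk0 => ?_⟩
    · have := (one_div_le hi hφ).1 hle
      linarith
    -- A second root contributes a positive term to the potential, which makes the bound strict.
    · have hlt : 1 / (r i - y) < φ := by
        refine lt_of_lt_of_le ?_ hr3
        have : Nontrivial (Fin (k + 1)) := Fin.nontrivial_iff_two_le.2 (by omega)
        obtain ⟨j, hj⟩ := exists_ne i
        exact Finset.single_lt_sum (f := fun i => 1 / (r i - y)) hj (Finset.mem_univ i)
          (Finset.mem_univ j) (one_div_pos.2 (sub_pos.2 (hr2 j)))
          fun m _ _ => one_div_nonneg.2 (sub_pos.2 (hr2 m)).le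
      have := (one_div_lt hi hφ).1 hlt
      linarith
  rcases Nat.eq_zero_or_pos k with rfl | hk0
  · have hε2 : 0 < 1 - ε ^ 2 := by nlinarith
    -- For `k = 0` the optimal `φ` degenerates to `0`; this one gives `1 / (2 - ε²) > ε²`.
    obtain ⟨r, hr1, hr2⟩ := main ((1 - ε ^ 2) / τ) (by positivity)
    refine ⟨r, hr1, fun i => lt_of_lt_of_le ?_ (hr2 i).1⟩
    rw [div_mul_cancel₀ _ hτ.ne', Nat.cast_zero, zero_div, sub_zero, lt_div_iff₀ (by linarith)]
    nlinarith [sq_pos_of_pos hε2]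
  · have hk0' : (0 : ℝ) < k := Nat.cast_pos.2 hk0
    set c := √(k * τ) with hc
    have hc0 : 0 < c := Real.sqrt_pos.2 (by positivity)
    have hcsq : c ^ 2 = k * τ := Real.sq_sqrt (by positivity)
    have hc1 : c ≤ 1 - ε := by
      rw [hc, Real.sqrt_le_left (by linarith)]; exact hk
    have hc2 : 0 < 1 - c := by linarith
    -- The optimal `φ`: the bound becomes `(1 - c) - c (1 - c) = (1 - c)²`.
    obtain ⟨r, hr1, hr2⟩ := main (c / (τ * (1 - c))) (by positivity)
    refine ⟨r, hr1, fun i => lt_of_le_of_lt ?_ ((hr2 i).2 hk0)⟩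
    have e1 : 1 / (1 + c / (τ * (1 - c)) * τ) = 1 - c := by
      have := hc2.ne'
      field_simp
      ring
    have e2 : (k : ℝ) / (c / (τ * (1 - c))) = c * (1 - c) := by
      rw [div_div_eq_mul_div, div_eq_iff hc0.ne']
      linear_combination (-(1 - c)) * hcsq
    rw [e1, e2]
    nlinarith

theorem expectedGramPoly_nil_pos {ι d κ : Type*} [Fintype ι] [Fintype d] [DecidableEq d]
    [Fintype κ] [DecidableEq κ] (w : ι → ℝ) (v : ι → d → ℝ) (hw : ∑ i, w i = 1)
    (E : Matrix d κ ℝ) (F : Matrix κ d ℝ) (hEF : ∑ i, w i • outer ℝ (v i) = E * F)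
    {μ : κ → ℝ} (hdet : ∀ t : ℝ, (1 + t • (F * E)).det = ∏ i, (1 + t * μ i))
    (hμ : ∀ i, 0 ≤ μ i) (h1 : ∑ i, μ i = 1) {k : ℕ} {ε : ℝ} (hε₀ : 0 < ε) (hε₁ : ε < 1)
    (hk : k * ∑ i, μ i ^ 2 ≤ (1 - ε) ^ 2) {x : ℝ} (hx : x ≤ ε ^ 2) :
    0 < (expectedGramPoly w v (k + 1) []).eval x := by
  obtain ⟨r, hr1, hr2⟩ := exists_roots_gt_sq hμ h1 hε₀ hε₁ hk
  rw [expectedGramPoly_nil_eq w v hw E F hEF μ hdet, hr1, eval_mul, eval_C, eval_prod]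
  have : (-1 : ℝ) ^ (k + 1) = ∏ _i : Fin (k + 1), (-1 : ℝ) := by simp
  rw [this, ← Finset.prod_mul_distrib]
  refine Finset.prod_pos fun i _ => ?_
  have := hr2 i
  simp
  linarith

/-! ### Singular values, and the passage from polynomials to columns. -/

theorem charpoly_transpose_mul_self_eq {n m : ℕ} (A : Matrix (Fin n) (Fin m) ℝ) :
    (Aᵀ * A).charpoly
      = ∏ i : Fin m, (X - C (A.toEuclideanLin.singularValues i ^ 2)) := by
  have hT := A.toEuclideanLin.isSymmetric_adjoint_comp_self
  have hn : Module.finrank ℝ (EuclideanSpace ℝ (Fin m)) = m := finrank_euclideanSpace_fin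
  have h1 : LinearMap.adjoint A.toEuclideanLin ∘ₗ A.toEuclideanLin = (Aᵀ * A).toEuclideanLin := by
    rw [← toEuclideanLin_conjTranspose_eq_adjoint, conjTranspose_eq_transpose_of_trivial]
    ext x i
    simp
  have h2 : (Aᵀ * A).toEuclideanLin.charpoly = (Aᵀ * A).charpoly := by
    rw [toEuclideanLin, toLpLin_eq_toLin]
    exact charpoly_toLin _ _
  rw [← h2, ← h1, hT.charpoly_eq hn]
  exact Finset.prod_congr rfl fun i _ => by
    rw [A.toEuclideanLin.sq_singularValues_fin hn]; rfl

theorem sum_sq_singularValues {n m : ℕ} (A : Matrix (Fin n) (Fin m) ℝ) :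
    ∑ i : Fin m, A.toEuclideanLin.singularValues i ^ 2 = ∑ j, ∑ i, A i j ^ 2 := by
  have h := charpoly_transpose_mul_self_eq A
  have hroots : (Aᵀ * A).charpoly.roots
      = Finset.univ.val.map fun i : Fin m => A.toEuclideanLin.singularValues i ^ 2 := by
    rw [h, ← roots_multiset_prod_X_sub_C (Finset.univ.val.map _), Multiset.map_map]
    rfl
  have hs : (Aᵀ * A).charpoly.Splits := by
    rw [h]
    exact Splits.prod fun i _ => Splits.X_sub_C _
  have ht := trace_eq_sum_roots_charpoly_of_splits hs
  rw [hroots] at ht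
  refine Eq.trans ht.symm ?_
  simp [trace, mul_apply, sq]

/-- A negative eigenvalue `λ` of `G - b` would make `b + λ < b` a zero of `det (G - x)`. -/
theorem dotProduct_self_ge_of_expectedGramPoly_pos {ι d : Type*} [Fintype ι] [Fintype d]
    (w : ι → ℝ) (v : ι → d → ℝ) (L : List ι) {b : ℝ}
    (h : ∀ x ≤ b, 0 < (expectedGramPoly w v 0 L).eval x) (c : Fin L.length → ℝ) :
    b * (c ⬝ᵥ c) ≤ (listCols v L *ᵥ c) ⬝ᵥ (listCols v L *ᵥ c) := by
  classical
  set G := (listCols v L)ᵀ * listCols v L with hG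
  have hH : (G - scalar _ b).IsHermitian := by
    refine (posSemidef_listCols v L).isHermitian.sub ?_
    rw [scalar_apply]
    exact isHermitian_diagonal _
  have hpos : (G - scalar _ b).PosSemidef := by
    rw [hH.posSemidef_iff_eigenvalues_nonneg]
    intro i
    by_contra! hneg
    have h1 := h (b + hH.eigenvalues i) (by simpa using hneg.le)
    have h2 : (G - scalar _ b).charpoly.eval (hH.eigenvalues i) = 0 := by
      rw [hH.charpoly_eq, eval_prod]
      exact Finset.prod_eq_zero (Finset.mem_univ i) (by simp)
    rw [eval_charpoly, ← neg_sub, det_neg, sub_sub, ← map_add,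
      ← eval_expectedGramPoly_zero w v L] at h2
    rcases mul_eq_zero.1 h2 with h3 | h3
    · exact pow_ne_zero _ (by norm_num) h3
    · exact h1.ne' h3
  have h1 := hpos.dotProduct_mulVec_nonneg c
  have h2 : scalar (Fin L.length) b *ᵥ c = b • c := by
    ext i; simp [scalar_apply, mulVec_diagonal]
  have h3 : c ⬝ᵥ G *ᵥ c = (listCols v L *ᵥ c) ⬝ᵥ (listCols v L *ᵥ c) := by
    rw [hG, ← mulVec_mulVec, dotProduct_mulVec, vecMul_transpose]
  rw [star_trivial, sub_mulVec, dotProduct_sub, h2, h3, dotProduct_smul, smul_eq_mul] at h1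
  linarith

theorem nodup_of_expectedGramPoly_pos {ι d : Type*} [Fintype ι] [Fintype d]
    (w : ι → ℝ) (v : ι → d → ℝ) (L : List ι) {b : ℝ} (hb : 0 < b)
    (h : ∀ x ≤ b, 0 < (expectedGramPoly w v 0 L).eval x) : L.Nodup := by
  rw [List.nodup_iff_injective_get]
  intro i j hij
  by_contra hne
  have h1 := dotProduct_self_ge_of_expectedGramPoly_pos w v L h
    -- A repeated column puts this vector, of squared norm `2`, in the kernel.
    (Pi.single i 1 - Pi.single j 1)
  have h2 : listCols v L *ᵥ (Pi.single i 1 - Pi.single j 1) = 0 := by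
    rw [mulVec_sub, mulVec_single_one, mulVec_single_one, sub_eq_zero]
    ext a
    simp only [listCols, col_apply, of_apply, hij]
  rw [h2, zero_dotProduct] at h1
  have h3 : (Pi.single i 1 - Pi.single j 1 : Fin L.length → ℝ) ⬝ᵥ
      (Pi.single i 1 - Pi.single j 1) = 2 := by
    have h4 : j ≠ i := Ne.symm hne
    simp [dotProduct_sub, hne, h4]
    norm_num
  rw [h3] at h1
  linarith

theorem le_sigmaMin_of_expectedGramPoly_pos {n m : ℕ} (M : Matrix (Fin n) (Fin m) ℝ)
    (w : Fin m → ℝ) (L : List (Fin m)) (hL : L ≠ []) {ε : ℝ} (hε : 0 < ε)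
    (h : ∀ x ≤ ε ^ 2, 0 < (expectedGramPoly w (fun j i => M i j) 0 L).eval x) :
    ε ≤ sigmaMin (colsSubmatrix M L.toFinset) := by
  have hnd := nodup_of_expectedGramPoly_pos w _ L (by positivity) h
  have hne : Nonempty L.toFinset := by
    obtain ⟨i, hi⟩ := List.exists_mem_of_ne_nil L hL
    exact ⟨i, List.mem_toFinset.2 hi⟩
  have hne' : Nonempty (Metric.sphere (0 : EuclideanSpace ℝ L.toFinset) 1) :=
    ⟨⟨EuclideanSpace.single hne.some 1, by simp⟩⟩
  refine le_ciInf fun y => ?_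
  obtain ⟨y, hy⟩ := y
  rw [mem_sphere_zero_iff_norm] at hy
  let f : Fin m → ℝ := fun j => if hj : j ∈ L.toFinset then y ⟨j, hj⟩ else 0
  have hf : ∀ j : L.toFinset, y j = f j := fun j => by simp only [f, dif_pos j.2]
  have hsum : ∀ g : Fin m → ℝ, ∑ a : Fin L.length, g (L.get a) = ∑ j : L.toFinset, g j :=
    fun g => by
      rw [Finset.sum_coe_sort L.toFinset g, List.sum_toFinset g hnd, ← Fin.sum_univ_fun_getElem]
      rfl
  have h1 := dotProduct_self_ge_of_expectedGramPoly_pos w (fun j i => M i j) L h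
    fun a => f (L.get a)
  have h2 : (fun a => f (L.get a)) ⬝ᵥ (fun a => f (L.get a)) = 1 := by
    rw [dotProduct, hsum fun j => f j * f j]
    have := EuclideanSpace.real_norm_sq_eq y
    rw [hy, one_pow] at this
    rw [this]
    exact Finset.sum_congr rfl fun j _ => by rw [hf, sq]
  have h3 : listCols (fun j i => M i j) L *ᵥ (fun a => f (L.get a))
      = (colsSubmatrix M L.toFinset).toEuclideanLin y := by
    ext i
    rw [ofLp_toLpLin, toLin'_apply]
    simp only [mulVec, dotProduct, listCols, of_apply, colsSubmatrix, submatrix_apply, id]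
    rw [hsum fun j => M i j * f j]
    exact Finset.sum_congr rfl fun j _ => by rw [hf]
  rw [h2, h3, mul_one] at h1
  refine le_of_sq_le_sq ?_ (norm_nonneg _)
  rw [EuclideanSpace.real_norm_sq_eq]
  refine h1.trans (le_of_eq ?_)
  exact Finset.sum_congr rfl fun i _ => by rw [sq]

theorem corollary1p4 {n m : ℕ} (A : Matrix (Fin n) (Fin m) ℝ) (hA : A ≠ 0)
    (ε : ℝ) (hε₀ : 0 < ε) (hε₁ : ε < 1) :
    ∃ S : Finset (Fin m), S.card = ⌊(1 - ε) ^ 2 * srankFour A⌋₊ + 1 ∧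
      ε ≤ sigmaMin (colsSubmatrix (normalizeCols A) S) := by
  set σ : Fin m → ℝ := fun i => A.toEuclideanLin.singularValues i with hσ
  set s : ℝ := ∑ i, σ i ^ 2 with hs
  have hcol : ∀ j, ‖WithLp.toLp 2 (A.col j)‖ ^ 2 = ∑ i, A i j ^ 2 := fun j => by
    rw [EuclideanSpace.real_norm_sq_eq]; rfl
  have hsA : s = ∑ j, ‖WithLp.toLp 2 (A.col j)‖ ^ 2 := by
    simp only [hcol]; exact sum_sq_singularValues A
  have hs0 : 0 < s := by
    rw [hsA]
    obtain ⟨i, j, hij⟩ : ∃ i j, A i j ≠ 0 := by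
      by_contra! hc
      exact hA (Matrix.ext hc)
    refine Finset.sum_pos' (fun j _ => sq_nonneg _) ⟨j, Finset.mem_univ j, ?_⟩
    rw [hcol]
    exact Finset.sum_pos' (fun i _ => sq_nonneg _) ⟨i, Finset.mem_univ i, by positivity⟩
  let w : Fin m → ℝ := fun j => ‖WithLp.toLp 2 (A.col j)‖ ^ 2 / s
  let v : Fin m → Fin n → ℝ := fun j i => normalizeCols A i j
  let μ : Fin m → ℝ := fun i => σ i ^ 2 / s
  have hw0 : ∀ j, 0 ≤ w j := fun j => by positivity
  have hw : ∑ j, w j = 1 := by rw [← Finset.sum_div, ← hsA, div_self hs0.ne']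
  have hμ1 : ∑ i, μ i = 1 := by rw [← Finset.sum_div, ← hs, div_self hs0.ne']
  have hEF : ∑ j, w j • outer ℝ (v j) = (s⁻¹ • A) * Aᵀ := by
    ext a b
    simp only [Matrix.sum_apply, Matrix.smul_apply, outer, vecMulVec_apply, Function.comp_apply,
      Algebra.algebraMap_self, RingHom.id_apply, mul_apply, transpose_apply, smul_eq_mul, v, w,
      normalizeCols, of_apply]
    refine Finset.sum_congr rfl fun j _ => ?_
    -- The weight `‖a_j‖² / s` cancels the normalization; a zero column contributes zero to both
    -- sides.
    by_cases h0 : ‖WithLp.toLp 2 (A.col j)‖ = 0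
    · have h1 := hcol j
      rw [h0, zero_pow two_ne_zero, eq_comm,
        Finset.sum_eq_zero_iff_of_nonneg fun i _ => sq_nonneg _] at h1
      have h2 : A a j = 0 := by simpa using h1 a (Finset.mem_univ a)
      simp [h2]
    · field_simp
  have hdet : ∀ t : ℝ, (1 + t • (Aᵀ * (s⁻¹ • A))).det = ∏ i, (1 + t * μ i) := fun t => by
    rw [Matrix.mul_smul, smul_smul,
      det_one_add_smul_of_charpoly (charpoly_transpose_mul_self_eq A)]
    exact Finset.prod_congr rfl fun i _ => by simp only [μ, hσ]; ring
  have hk : (⌊(1 - ε) ^ 2 * srankFour A⌋₊ : ℝ) * ∑ i, μ i ^ 2 ≤ (1 - ε) ^ 2 := by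
    have h4 : ∑ i, μ i ^ 2 = (∑ i, σ i ^ 4) / s ^ 2 := by
      rw [Finset.sum_div]
      exact Finset.sum_congr rfl fun i _ => by simp only [μ]; ring
    have hsr : srankFour A = s ^ 2 / ∑ i, σ i ^ 4 := by
      rw [srankFour, Finset.sum_range, Finset.sum_range]
    have h4pos : 0 ≤ ∑ i, σ i ^ 4 := Finset.sum_nonneg fun i _ => by positivity
    have hle := Nat.floor_le (a := (1 - ε) ^ 2 * srankFour A) (by rw [hsr]; positivity)
    rw [h4]
    refine (mul_le_mul_of_nonneg_right hle (by positivity)).trans ?_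
    rw [hsr]
    rcases h4pos.eq_or_lt with h0 | h0
    · rw [← h0]; simp; positivity
    · exact le_of_eq (by field_simp)
  obtain ⟨L, hL, hpos⟩ := exists_list_expectedGramPoly_pos w v hw0 hw (sq_pos_of_pos hε₀)
    (⌊(1 - ε) ^ 2 * srankFour A⌋₊ + 1) [] fun x hx =>
      expectedGramPoly_nil_pos w v hw _ _ hEF hdet (fun i => by positivity) hμ1 hε₀ hε₁ hk hx
  rw [List.length_nil, add_zero] at hL
  refine ⟨L.toFinset, ?_, le_sigmaMin_of_expectedGramPoly_pos (normalizeCols A) w L ?_ hε₀ hpos⟩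
  · rw [List.toFinset_card_of_nodup
      (nodup_of_expectedGramPoly_pos w v L (sq_pos_of_pos hε₀) hpos), hL]
  · rintro rfl
    simp at hL
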